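/- Let $\Omega\subset\{x\in\mathbb R^d:\|x\|_\infty\le R\}$ be compact and let $P$ be a probability measure with $P(\Omega)=1$. Let $f:\mathbb R^d\to\mathbb R$ be convex with $|f|\le M$ on $\Omega$ and with $$\|f\|:=\sum_{l=1}^d\ \sup_{x\in\Omega}\ \sup_{p\in\partial f(x)}|p_l|\ \le L<\infty ,$$ where $\partial f(x)$ is the subdifferential. Let $n\ge d\ge 1$ and let $y_i=f(x_i)+\varepsilon_i$, $i=1,\dots,n$, where $x_1,\dots,x_n$ are i.i.d. with law $P$, and $\varepsilon_1,\dots,\varepsilon_n$ are independent of each other and of $(x_1,\dots,x_n)$, with $\mathbb E\varepsilon_i=0$ and $|\varepsilon_i|\le M$ almost surely. For $\lambda>0$ consider the program $$\min_{\hat y_i\in\mathbb R,\ a_i\in\mathbb R^d}\ \frac1n\sum_{i=1}^n(\hat y_i-y_i)^2+\lambda\sum_{l=1}^d\max_{1\le i\le n}|a_{i,l}|\quad\text{subject to}\quad \hat y_i-\hat y_j-\langle a_i,x_i-x_j\rangle\le 0\ \text{ for all } i,j,$$ and the estimator $\hat f(x)=\max_{1\le i\le n}\big(\langle a_i,x-x_i\rangle+\hat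 y_i\big)$ given by a solution of it. For every $M>0$ there is a choice of $\lambda=\lambda(M,n,d,\delta)>0$, which depends neither on $\|f\|$ nor on $R$, $P$ or the law of the noise, such that for all $R,L>0$ there is a constant $C$ depending only on $M,R,L$ with the following property. For all $n\ge d\ge1$, $\delta\in(0,1)$ and all $\Omega,P,f,(x_i),(\varepsilon_i)$ as above, the program with parameter $\lambda$ has a solution, and with probability at least $1-\delta$ over the data every solution of it yields an estimator with $$\mathbb E_{x\sim P}\big[|f(x)-\hat f(x)|^2\big]\ \le\ C\left(\Big(\frac nd\Big)^{-\frac{2}{d+4}}\max\Big\{1,\log\frac nd\Big\}+\sqrt{\frac{\log(1/\delta)}{n}}\right).$$ -/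

import Mathlib

open MeasureTheory ProbabilityTheory Matrix
open scoped ENNReal

namespace ConvexRegression

/-- The subdifferential at `x` of a convex function `f` on `ℝ^d`. (The norm of `Fin d → ℝ` is
the sup norm, `⬝ᵥ` is the standard inner product.) -/
def subdifferential {d : ℕ} (f : (Fin d → ℝ) → ℝ) (x : Fin d → ℝ) : Set (Fin d → ℝ) :=
  {p | ∀ z, f x + p ⬝ᵥ (z - x) ≤ f z}

/-- The seminorm `‖f‖ = ∑_l sup_{x ∈ Ω} |∂*_{x_l} f(x)|`, where `|∂*_{x_l} f(x)|` is the largest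
absolute value of an `l`-th partial sub-derivative of `f` at `x`. Values in `[0, ∞]`. -/
noncomputable def penalty {d : ℕ} (Ω : Set (Fin d → ℝ)) (f : (Fin d → ℝ) → ℝ) : ℝ≥0∞ :=
  ∑ l : Fin d, ⨆ x ∈ Ω, ⨆ p ∈ subdifferential f x, ENNReal.ofReal |p l|

/-- The constraints `ŷ_i - ŷ_j - ⟨a_i, x_i - x_j⟩ ≤ 0` of the penalized convex regression
program with predictors `x_1, …, x_n`. -/
def Feasible {n d : ℕ} (x : Fin n → Fin d → ℝ) (yhat : Fin n → ℝ) (a : Fin n → Fin d → ℝ) :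
    Prop :=
  ∀ i j, yhat i - yhat j - a i ⬝ᵥ (x i - x j) ≤ 0

/-- The objective `(1/n) ∑_i (ŷ_i - y_i)² + lam ∑_l max_i |a_{i,l}|`. -/
noncomputable def objective {n d : ℕ} (lam : ℝ) (y : Fin n → ℝ)
    (yhat : Fin n → ℝ) (a : Fin n → Fin d → ℝ) : ℝ :=
  (1 / (n : ℝ)) * ∑ i, (yhat i - y i) ^ 2 + lam * ∑ l : Fin d, ⨆ i : Fin n, |a i l|

/-- `(ŷ, a)` is an optimal solution of the penalized convex regression program
with data `(x_i, y_i)` and regularization parameter `lam`. -/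
def IsSolution {n d : ℕ} (lam : ℝ) (x : Fin n → Fin d → ℝ) (y : Fin n → ℝ)
    (yhat : Fin n → ℝ) (a : Fin n → Fin d → ℝ) : Prop :=
  Feasible x yhat a ∧
    ∀ (yhat' : Fin n → ℝ) (a' : Fin n → Fin d → ℝ), Feasible x yhat' a' →
      objective lam y yhat a ≤ objective lam y yhat' a'

/-- The max-affine estimator `f̂(z) = max_i (⟨a_i, z - x_i⟩ + ŷ_i)`. -/
noncomputable def estimator {n d : ℕ} (x : Fin n → Fin d → ℝ)
    (yhat : Fin n → ℝ) (a : Fin n → Fin d → ℝ) (z : Fin d → ℝ) : ℝ :=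
  ⨆ i : Fin n, (a i ⬝ᵥ (z - x i) + yhat i)

/-- The excess risk `E |f(X) - g(X)|²` of `g`, for `X` of law `P`. Values in `[0, ∞]`. -/
noncomputable def excessRisk {d : ℕ} (P : Measure (Fin d → ℝ)) (f g : (Fin d → ℝ) → ℝ) : ℝ≥0∞ :=
  ∫⁻ z, ENNReal.ofReal (|f z - g z| ^ 2) ∂P

/-- The rate `(n/d)^{-2/(d+4)} max{1, log(n/d)} + √(log(1/δ)/n)`. -/
noncomputable def rate (n d : ℕ) (δ : ℝ) : ℝ :=
  ((n : ℝ) / d) ^ (-2 / ((d : ℝ) + 4)) * max 1 (Real.log ((n : ℝ) / d))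
    + √(Real.log (1 / δ) / n)

end ConvexRegression

/-! The regularization parameter is `rate n d δ` itself, written `lam`. Comparing a solution with
the true values `f (x i)` and subgradients of `f` there (`IsSolution.basic_inequality`) bounds the
empirical squared error plus `lam` times the slope size `slopeNorm a` by a noise correlation plus
`lam * L`.

The noise term is controlled uniformly by a union bound. The slope size `θ` is random and only known
a priori to satisfy `θ ≤ 4 * M ^ 2 / lam`, so the estimator is written as an integer scale `T` times
a member of `UnitClass`, and the bound runs over all such scales and a finite sup-norm cover. The
tail bound is offset by an eighth of the empirical squared norm, which the error absorbs; the cover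
error, proportional to `T`, is absorbed by the penalty. This gives empirical error `O(lam)` and also
`θ ≤ Θ` with `Θ` depending only on `M` and `L`, which is why `lam` need not know `L`. At the fixed
scale `Θ + 1`, Hoeffding's inequality on the same cover passes to the population
(`IsSolution.excessRisk_le`).

The rate comes from `exists_cover_unitClass`: at accuracy `e` the log-cardinality is about `(Q / √e)
^ d * d` times a logarithm, with `Q` independent of `d`. For `e` of order `(n / d) ^ (-2 / (d + 4))`
this is at most of order `n * lam ^ 2`, which the tails `exp (-8 * n * lam ^ 2)` beat
(`exists_rate_threshold`). This needs `lam` below a threshold `c` depending on `M` and `R`; above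
it, boundedness of the estimator suffices. -/

namespace ConvexRegression

/-! ### Tail bounds for weighted noise and for empirical means. -/

section Concentration

variable {S : Type*} [MeasurableSpace S] {μ : Measure S} [IsProbabilityMeasure μ]

/-- Offset tail bound for a weighted sum of independent, centered, bounded variables. -/
lemma measure_offset_le_weighted_sum {n : ℕ} {M t : ℝ} (hM : 0 < M) (ht : 0 < t)
    {ε : Fin n → S → ℝ} (hε : ∀ i, Measurable (ε i)) (hind : iIndepFun ε μ)
    (hb : ∀ i, ∀ᵐ ω ∂μ, |ε i ω| ≤ M) (hmean : ∀ i, ∫ ω, ε i ω ∂μ = 0) (c : Fin n → ℝ) :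
    μ {ω | (∑ i, c i ^ 2) / 8 + t ≤ ∑ i, ε i ω * c i}
      ≤ ENNReal.ofReal (Real.exp (-t / (4 * M ^ 2))) := by
  have hsub : ∀ i ∈ (Finset.univ : Finset (Fin n)),
      HasSubgaussianMGF (fun ω => c i * ε i ω) (c i ^ 2 * M ^ 2).toNNReal μ := by
    intro i _
    have h := (hasSubgaussianMGF_of_mem_Icc_of_integral_eq_zero (a := -M) (b := M)
      (hε i).aemeasurable (by filter_upwards [hb i] with ω h using abs_le.1 h)
      (hmean i)).const_mul (c i)
    convert h using 1
    apply NNReal.eq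
    have hMM : |M - -M| / 2 = M := by rw [abs_of_nonneg (by linarith)]; ring
    rw [Real.coe_toNNReal _ (by positivity)]
    change _ = c i ^ 2 * (‖M - -M‖ / 2) ^ 2
    rw [Real.norm_eq_abs, hMM]
  have hind' : iIndepFun (fun i ω => c i * ε i ω) μ :=
    hind.comp (fun i r => c i * r) (fun i => measurable_const_mul _)
  set a := ∑ i, c i ^ 2 with ha
  have ha0 : 0 ≤ a := Finset.sum_nonneg fun i _ => sq_nonneg _
  have key := HasSubgaussianMGF.measure_sum_ge_le_of_iIndepFun hind' hsub (ε := a / 8 + t) (by positivity)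
  have hsum : ((∑ i, (c i ^ 2 * M ^ 2).toNNReal : NNReal) : ℝ) = M ^ 2 * a := by
    rw [NNReal.coe_sum, ha, Finset.mul_sum]
    exact Finset.sum_congr rfl fun i _ => by
      rw [Real.coe_toNNReal _ (by positivity), mul_comm]
  rw [hsum] at key
  rw [← ofReal_measureReal]
  apply ENNReal.ofReal_le_ofReal
  simp only [mul_comm (c _)] at key
  -- If all weights vanish, the sub-Gaussian exponent is a division by zero and the bound is only
  -- `1`; but then the event is empty because `t > 0`.
  rcases ha0.eq_or_lt with h0 | hpos
  · have hc : ∀ i, c i = 0 := by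
      intro i
      have := (Finset.sum_eq_zero_iff_of_nonneg (fun i _ => sq_nonneg (c i))).1 (ha ▸ h0.symm) i
        (Finset.mem_univ _)
      exact pow_eq_zero_iff (two_ne_zero) |>.1 this
    have : {ω | a / 8 + t ≤ ∑ i, ε i ω * c i} = ∅ := by
      ext ω
      simp [hc, ← h0, ht]
    rw [this]
    simp only [measureReal_empty]
    positivity
  · refine key.trans (Real.exp_le_exp.2 ?_)
    rw [div_le_div_iff₀ (by positivity) (by positivity)]
    -- By AM-GM, `(a / 8 + t) ^ 2 ≥ a * t / 2`, so the variance proxy `M ^ 2 * a` cancels and the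
    -- exponent no longer depends on the weights.
    nlinarith [mul_nonneg (sq_nonneg M) (sq_nonneg (a / 8 - t)), mul_pos hM hM]

/-- By independence the joint law is a product; for a frozen design the values `g (x i)` are
deterministic weights, and the fixed-weight bound, uniform in them, is integrated over the design.
-/
lemma measure_offset_le_sum {n d : ℕ} {M t : ℝ} (hM : 0 < M) (ht : 0 < t)
    {x : Fin n → S → Fin d → ℝ} {ε : Fin n → S → ℝ} (hx : ∀ i, Measurable (x i))
    (hε : ∀ i, Measurable (ε i)) (hind : iIndepFun ε μ)
    (hindx : IndepFun (fun ω i => x i ω) (fun ω i => ε i ω) μ)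
    (hb : ∀ i, ∀ᵐ ω ∂μ, |ε i ω| ≤ M) (hmean : ∀ i, ∫ ω, ε i ω ∂μ = 0)
    {g : (Fin d → ℝ) → ℝ} (hg : Measurable g) :
    μ {ω | (∑ i, g (x i ω) ^ 2) / 8 + t ≤ ∑ i, ε i ω * g (x i ω)}
      ≤ ENNReal.ofReal (Real.exp (-t / (4 * M ^ 2))) := by
  have hxv : Measurable (fun ω i => x i ω) := measurable_pi_lambda _ hx
  have hεv : Measurable (fun ω i => ε i ω) := measurable_pi_lambda _ hε
  have hmap := hindx.map_prod_eq_prod_map_map hxv.aemeasurable hεv.aemeasurable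
  let A : Set ((Fin n → Fin d → ℝ) × (Fin n → ℝ)) :=
    {p | (∑ i, g (p.1 i) ^ 2) / 8 + t ≤ ∑ i, p.2 i * g (p.1 i)}
  have hA : MeasurableSet A := by
    apply measurableSet_le
    · fun_prop
    · fun_prop
  have h1 : μ {ω | (∑ i, g (x i ω) ^ 2) / 8 + t ≤ ∑ i, ε i ω * g (x i ω)}
      = μ.map (fun ω => ((fun i => x i ω), (fun i => ε i ω))) A := by
    rw [Measure.map_apply (hxv.prodMk hεv) hA]
    rfl
  have : IsProbabilityMeasure (μ.map (fun ω i => x i ω)) :=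
    Measure.isProbabilityMeasure_map hxv.aemeasurable
  have : IsProbabilityMeasure (μ.map (fun ω i => ε i ω)) :=
    Measure.isProbabilityMeasure_map hεv.aemeasurable
  rw [h1, hmap, Measure.prod_apply hA]
  calc _ ≤ ∫⁻ _, ENNReal.ofReal (Real.exp (-t / (4 * M ^ 2))) ∂(μ.map (fun ω i => x i ω)) := by
        apply lintegral_mono
        intro u
        dsimp only
        rw [Measure.map_apply hεv (measurable_prodMk_left hA)]
        exact measure_offset_le_weighted_sum hM ht hε hind hb hmean (fun i => g (u i))
    _ = _ := by simp

/-- Lower-tail Hoeffding inequality for the empirical mean of a bounded function. -/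
lemma measure_sum_le_integral_sub {n d : ℕ} {b t : ℝ} (hb : 0 < b) (ht : 0 ≤ t)
    {P : Measure (Fin d → ℝ)} [IsProbabilityMeasure P]
    {x : Fin n → S → Fin d → ℝ} (hx : ∀ i, Measurable (x i)) (hind : iIndepFun x μ)
    (hlaw : ∀ i, μ.map (x i) = P) {φ : (Fin d → ℝ) → ℝ} (hφ : Measurable φ)
    (h0 : ∀ᵐ z ∂P, φ z ∈ Set.Icc 0 b) :
    μ {ω | ∑ i, φ (x i ω) ≤ n * (∫ z, φ z ∂P - t)}
      ≤ ENNReal.ofReal (Real.exp (-(2 * n * t ^ 2) / b ^ 2)) := by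
  have hmem : ∀ i, ∀ᵐ ω ∂μ, -φ (x i ω) ∈ Set.Icc (-b) 0 := by
    intro i
    rw [← hlaw i] at h0
    filter_upwards [ae_of_ae_map (hx i).aemeasurable h0] with ω h
    exact ⟨neg_le_neg h.2, neg_nonpos.2 h.1⟩
  have hint : ∀ i, ∫ ω, -φ (x i ω) ∂μ = -∫ z, φ z ∂P := by
    intro i
    rw [integral_neg, ← hlaw i, integral_map (hx i).aemeasurable hφ.aestronglyMeasurable]
  have hsub : ∀ i ∈ (Finset.univ : Finset (Fin n)), HasSubgaussianMGF
      (fun ω => -φ (x i ω) + ∫ z, φ z ∂P) ((‖(0 : ℝ) - (-b)‖₊ / 2) ^ 2) μ := by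
    intro i _
    have := hasSubgaussianMGF_of_mem_Icc (μ := μ) (X := fun ω => -φ (x i ω)) (a := -b) (b := 0)
      (by fun_prop) (hmem i)
    rw [hint i] at this
    simpa using this
  have hind' : iIndepFun (fun i ω => -φ (x i ω) + ∫ z, φ z ∂P) μ :=
    hind.comp (fun _ z => -φ z + ∫ z, φ z ∂P) (fun _ => by fun_prop)
  have key := HasSubgaussianMGF.measure_sum_ge_le_of_iIndepFun hind' hsub (ε := n * t) (by positivity)
  rw [← ofReal_measureReal]
  apply ENNReal.ofReal_le_ofReal
  have hset : {ω | ∑ i, φ (x i ω) ≤ n * (∫ z, φ z ∂P - t)}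
      = {ω | n * t ≤ ∑ i, (-φ (x i ω) + ∫ z, φ z ∂P)} := by
    ext ω
    simp only [Set.mem_ofPred_eq, Finset.sum_add_distrib, Finset.sum_neg_distrib, Finset.sum_const,
      Finset.card_univ, Fintype.card_fin, nsmul_eq_mul]
    constructor <;> intro h <;> linarith
  rw [hset]
  refine key.trans (Real.exp_le_exp.2 ?_)
  have hsum : ((∑ _i : Fin n, (‖(0 : ℝ) - (-b)‖₊ / 2) ^ 2 : NNReal) : ℝ) = n * (b / 2) ^ 2 := by
    simp [abs_of_pos hb]
  rw [hsum]
  rcases Nat.eq_zero_or_pos n with rfl | hn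
  · simp
  · have hn' : (0 : ℝ) < n := by exact_mod_cast hn
    apply le_of_eq
    field_simp

end Concentration

/-! ### Subgradients, solutions of the program, and the max-affine estimator. -/

section ConvexAnalysis

lemma abs_dotProduct_le {d : ℕ} (p v : Fin d → ℝ) : |p ⬝ᵥ v| ≤ (∑ l, |p l|) * ‖v‖ := by
  rw [dotProduct, Finset.sum_mul]
  refine (Finset.abs_sum_le_sum_abs _ _).trans (Finset.sum_le_sum fun l _ => ?_)
  rw [abs_mul]
  exact mul_le_mul_of_nonneg_left (norm_le_pi_norm v l) (abs_nonneg _)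

/-- Hahn-Banach separates `(x, f x)` from the open strict epigraph. The vertical component `c` of
the functional is negative, and dividing its horizontal part by `-c` gives a subgradient. -/
lemma nonempty_subdifferential {d : ℕ} {f : (Fin d → ℝ) → ℝ} (hf : ConvexOn ℝ Set.univ f)
    (x : Fin d → ℝ) : (subdifferential f x).Nonempty := by
  have hcont : Continuous f := continuousOn_univ.1 (hf.continuousOn isOpen_univ)
  have hopen : IsOpen {q : (Fin d → ℝ) × ℝ | q.1 ∈ Set.univ ∧ f q.1 < q.2} := by
    simp only [Set.mem_univ, true_and]
    exact isOpen_lt (by fun_prop) (by fun_prop)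
  obtain ⟨F, hF⟩ := geometric_hahn_banach_open_point hf.convex_strict_epigraph hopen
    (show (x, f x) ∉ _ by simp)
  set c := F (0, 1) with hc
  have hsplit : ∀ (z : Fin d → ℝ) (s : ℝ), F (z, s) = F (z, 0) + s * c := by
    intro z s
    have h : ((z, s) : (Fin d → ℝ) × ℝ) = (z, 0) + s • (0, 1) := by simp
    rw [h, map_add, map_smul, smul_eq_mul]
  have hc0 : c < 0 := by
    have := hF (x, f x + 1) (by simp)
    rw [hsplit, hsplit x (f x)] at this
    linarith
  have hle : ∀ z, F (z, 0) + f z * c ≤ F (x, 0) + f x * c := by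
    intro z
    apply le_of_forall_pos_le_add
    intro η hη
    have hdiv : 0 < η / (-c) := div_pos hη (by linarith)
    have := hF (z, f z + η / (-c)) (by simp [hdiv])
    rw [hsplit, hsplit x (f x)] at this
    have h2 : η / (-c) * c = -η := by
      have := hc0.ne
      field_simp
    linarith
  refine ⟨fun l => F (Pi.single l 1, 0) / (-c), fun z => ?_⟩
  have hlin : ∀ w : Fin d → ℝ, (fun l => F (Pi.single l 1, 0) / (-c)) ⬝ᵥ w = F (w, 0) / (-c) := by
    intro w
    have hw : ((w, 0) : (Fin d → ℝ) × ℝ) =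
        ∑ l, w l • ((Pi.single l (1 : ℝ) : Fin d → ℝ), (0 : ℝ)) := by
      ext j
      · simp [Finset.sum_apply, Pi.single_apply, Prod.fst_sum]
      · simp [Prod.snd_sum]
    rw [hw, map_sum, Finset.sum_div, dotProduct]
    refine Finset.sum_congr rfl fun l _ => ?_
    rw [map_smul, smul_eq_mul]
    ring
  rw [hlin]
  have h1 : F (z - x, 0) = F (z, 0) - F (x, 0) := by
    rw [← map_sub]; simp
  have h2 : F (z - x, 0) / (-c) ≤ f z - f x := by
    rw [div_le_iff₀ (by linarith), h1]
    linarith [hle z]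
  linarith

/-- The size `∑_l max_i |a_{i,l}|` of a family of slopes. -/
noncomputable def slopeNorm {n d : ℕ} (a : Fin n → Fin d → ℝ) : ℝ := ∑ l, ⨆ i, |a i l|

lemma abs_le_iSup_abs {n d : ℕ} (a : Fin n → Fin d → ℝ) (i : Fin n) (l : Fin d) :
    |a i l| ≤ ⨆ i, |a i l| :=
  le_ciSup (f := fun i => |a i l|) (Set.finite_range _).bddAbove i

lemma sum_abs_le_slopeNorm {n d : ℕ} (a : Fin n → Fin d → ℝ) (i : Fin n) :
    ∑ l, |a i l| ≤ slopeNorm a :=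
  Finset.sum_le_sum fun l _ => abs_le_iSup_abs a i l

lemma slopeNorm_nonneg {n d : ℕ} (a : Fin n → Fin d → ℝ) : 0 ≤ slopeNorm a :=
  Finset.sum_nonneg fun _ _ => Real.iSup_nonneg fun _ => abs_nonneg _

lemma continuous_slopeNorm {n d : ℕ} (hn : 0 < n) :
    Continuous (slopeNorm : (Fin n → Fin d → ℝ) → ℝ) := by
  have : Nonempty (Fin n) := ⟨⟨0, hn⟩⟩
  have h : (slopeNorm : (Fin n → Fin d → ℝ) → ℝ) = fun a => ∑ l, ‖fun i => a i l‖ := by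
    ext a
    refine Finset.sum_congr rfl fun l _ => le_antisymm (ciSup_le fun i => ?_) ?_
    · exact norm_le_pi_norm (fun i => a i l) i
    · exact (pi_norm_le_iff_of_nonempty _).2 fun i => abs_le_iSup_abs a i l
  rw [h]
  fun_prop

lemma objective_eq {n d : ℕ} (lam : ℝ) (y yhat : Fin n → ℝ) (a : Fin n → Fin d → ℝ) :
    objective lam y yhat a = (1 / (n : ℝ)) * ∑ i, (yhat i - y i) ^ 2 + lam * slopeNorm a := rfl

/-- The feasible sublevel set through zero is compact: the squared loss bounds the fitted values,
and the penalty, as `lam > 0`, bounds the slopes. -/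
theorem exists_isSolution {n d : ℕ} (hn : 0 < n) {lam : ℝ} (hlam : 0 < lam)
    (x : Fin n → Fin d → ℝ) (y : Fin n → ℝ) : ∃ yhat a, IsSolution lam x y yhat a := by
  have hn' : (0 : ℝ) < n := by exact_mod_cast hn
  set V := objective lam y 0 (0 : Fin n → Fin d → ℝ) with hV
  let s : Set ((Fin n → ℝ) × (Fin n → Fin d → ℝ)) :=
    {q | Feasible x q.1 q.2 ∧ objective lam y q.1 q.2 ≤ V}
  have hobj : Continuous (fun q : (Fin n → ℝ) × (Fin n → Fin d → ℝ) =>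
      objective lam y q.1 q.2) := by
    simp only [objective_eq]
    have := continuous_slopeNorm (d := d) hn
    fun_prop
  have hclosed : IsClosed s := by
    have h1 : IsClosed {q : (Fin n → ℝ) × (Fin n → Fin d → ℝ) | Feasible x q.1 q.2} := by
      simp only [Feasible, Set.ofPred_forall]
      refine isClosed_iInter fun i => isClosed_iInter fun j => isClosed_le ?_ continuous_const
      simp only [dotProduct]
      fun_prop
    exact h1.inter (isClosed_le hobj continuous_const)
  have h0 : ((0, 0) : (Fin n → ℝ) × (Fin n → Fin d → ℝ)) ∈ s := by
    refine ⟨fun i j => ?_, le_rfl⟩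
    simp
  have hbdd : Bornology.IsBounded s := by
    rw [isBounded_iff_forall_norm_le]
    refine ⟨max (‖y‖ + (1 + n * V)) (V / lam), ?_⟩
    rintro ⟨u, a⟩ ⟨-, h⟩
    simp only [objective_eq] at h
    have hsq : 0 ≤ (1 / (n : ℝ)) * ∑ i, (u i - y i) ^ 2 := by positivity
    have hsl : 0 ≤ lam * slopeNorm a := mul_nonneg hlam.le (slopeNorm_nonneg a)
    have hV0 : 0 ≤ V := by linarith
    have hsum : ∑ i, (u i - y i) ^ 2 ≤ n * V := by
      have h3 : (1 / (n : ℝ)) * ∑ i, (u i - y i) ^ 2 ≤ V := by linarith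
      rwa [one_div, inv_mul_le_iff₀ hn'] at h3
    rw [Prod.norm_def]
    apply max_le_max
    · refine (pi_norm_le_iff_of_nonneg (by positivity)).2 fun i => ?_
      have h1 : (u i - y i) ^ 2 ≤ n * V :=
        (Finset.single_le_sum (f := fun i => (u i - y i) ^ 2) (fun i _ => sq_nonneg _)
          (Finset.mem_univ i)).trans hsum
      have h2 : |u i - y i| ≤ 1 + n * V := by
        rw [← sq_abs] at h1
        nlinarith [sq_nonneg (|u i - y i| - 1)]
      calc ‖u i‖ = ‖y i + (u i - y i)‖ := by congr 1; ring
        _ ≤ ‖y i‖ + ‖u i - y i‖ := norm_add_le _ _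
        _ ≤ _ := add_le_add (norm_le_pi_norm y i) h2
    · refine (pi_norm_le_iff_of_nonneg (by positivity)).2 fun i =>
        (pi_norm_le_iff_of_nonneg (by positivity)).2 fun l => ?_
      rw [le_div_iff₀ hlam]
      have h1 : ‖a i l‖ ≤ slopeNorm a :=
        (Finset.single_le_sum (f := fun l => |a i l|) (fun i _ => abs_nonneg _)
          (Finset.mem_univ l)).trans (sum_abs_le_slopeNorm a i)
      nlinarith
  obtain ⟨q, hq, hmin⟩ := (Metric.isCompact_of_isClosed_isBounded hclosed hbdd).exists_isMinOn
    ⟨_, h0⟩ hobj.continuousOn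
  refine ⟨q.1, q.2, hq.1, fun u a hua => ?_⟩
  by_cases h : objective lam y u a ≤ V
  · exact isMinOn_iff.1 hmin (u, a) ⟨hua, h⟩
  · exact hq.2.trans (not_le.1 h).le

/-- The zero competitor costs at most `4 * M ^ 2`. One moderate fitted value is enough later, since
the slopes then control the estimator on the whole ball. -/
lemma IsSolution.bounds {n d : ℕ} (hn : 0 < n) {lam M : ℝ} (hlam : 0 < lam) (hM : 0 < M)
    {x : Fin n → Fin d → ℝ} {y yhat : Fin n → ℝ} {a : Fin n → Fin d → ℝ}
    (h : IsSolution lam x y yhat a) (hy : ∀ i, |y i| ≤ 2 * M) :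
    lam * slopeNorm a ≤ 4 * M ^ 2 ∧ ∃ i, |yhat i| ≤ 4 * M := by
  have hn' : (0 : ℝ) < n := by exact_mod_cast hn
  have h0 := h.2 0 0 (fun i j => by simp)
  rw [objective_eq, objective_eq] at h0
  have hz : slopeNorm (0 : Fin n → Fin d → ℝ) = 0 := by simp [slopeNorm]
  have hy2 : ∑ i, ((0 : Fin n → ℝ) i - y i) ^ 2 ≤ n * (4 * M ^ 2) := by
    have : ∀ i ∈ Finset.univ, ((0 : Fin n → ℝ) i - y i) ^ 2 ≤ 4 * M ^ 2 := by
      intro i _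
      have := hy i
      rw [Pi.zero_apply, zero_sub, neg_sq, ← sq_abs]
      nlinarith [abs_nonneg (y i)]
    simpa using Finset.sum_le_card_nsmul _ _ _ this
  have hsl : 0 ≤ lam * slopeNorm a := mul_nonneg hlam.le (slopeNorm_nonneg a)
  have hsq : 0 ≤ (1 / (n : ℝ)) * ∑ i, (yhat i - y i) ^ 2 := by positivity
  have h1 : (1 / (n : ℝ)) * ∑ i, ((0 : Fin n → ℝ) i - y i) ^ 2 ≤ 4 * M ^ 2 := by
    rwa [one_div, inv_mul_le_iff₀ hn']
  rw [hz, mul_zero, add_zero] at h0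
  refine ⟨by linarith, ?_⟩
  by_contra! hcon
  have h2 : n * (4 * M ^ 2) < ∑ i, (yhat i - y i) ^ 2 := by
    have : ∑ _i : Fin n, 4 * M ^ 2 < ∑ i, (yhat i - y i) ^ 2 := by
      apply Finset.sum_lt_sum_of_nonempty ⟨⟨0, hn⟩, Finset.mem_univ _⟩
      intro i _
      have h3 : 2 * M < |yhat i - y i| := by
        have := abs_sub_abs_le_abs_sub (yhat i) (y i)
        linarith [hcon i, hy i]
      rw [← sq_abs (yhat i - y i)]
      nlinarith
    simpa using this
  have h3 : 4 * M ^ 2 < (1 / (n : ℝ)) * ∑ i, (yhat i - y i) ^ 2 := by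
    rwa [one_div, lt_inv_mul_iff₀ hn']
  linarith

lemma slopeNorm_le_of_penalty_le {n d : ℕ} (hn : 0 < n) {Ω : Set (Fin d → ℝ)}
    {f : (Fin d → ℝ) → ℝ} {L : ℝ} (hL : 0 ≤ L) (hpen : penalty Ω f ≤ ENNReal.ofReal L)
    {x p : Fin n → Fin d → ℝ} (hx : ∀ i, x i ∈ Ω) (hp : ∀ i, p i ∈ subdifferential f (x i)) :
    slopeNorm p ≤ L := by
  have : Nonempty (Fin n) := ⟨⟨0, hn⟩⟩
  rw [← ENNReal.ofReal_le_ofReal_iff hL, slopeNorm,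
    ENNReal.ofReal_sum_of_nonneg fun _ _ => Real.iSup_nonneg fun _ => abs_nonneg _]
  refine le_trans (Finset.sum_le_sum fun l _ => ?_) hpen
  obtain ⟨i, hi⟩ := exists_eq_ciSup_of_finite (f := fun i => |p i l|)
  rw [← hi]
  exact le_iSup₂_of_le (x i) (hx i) (le_iSup₂_of_le (p i) (hp i) le_rfl)

/-- Optimality against the truth: the values `f (x i)` with subgradients `p i` are feasible by the
subgradient inequality. Expand the squares and cancel the pure noise terms. -/
lemma IsSolution.basic_inequality {n d : ℕ} {lam : ℝ}
    {x p : Fin n → Fin d → ℝ} {ε yhat : Fin n → ℝ} {a : Fin n → Fin d → ℝ}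
    {f : (Fin d → ℝ) → ℝ}
    (h : IsSolution lam x (fun i => f (x i) + ε i) yhat a)
    (hp : ∀ i, p i ∈ subdifferential f (x i)) :
    (1 / (n : ℝ)) * ∑ i, (yhat i - f (x i)) ^ 2 + lam * slopeNorm a
      ≤ 2 * ((1 / (n : ℝ)) * ∑ i, ε i * (yhat i - f (x i))) + lam * slopeNorm p := by
  have h0 := h.2 (fun i => f (x i)) p (fun i j => by
    have h1 := hp i (x j)
    have h2 : p i ⬝ᵥ (x i - x j) = -(p i ⬝ᵥ (x j - x i)) := by
      rw [← dotProduct_neg, neg_sub]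
    rw [h2]
    linarith)
  rw [objective_eq, objective_eq] at h0
  have e1 : ∑ i, (yhat i - (f (x i) + ε i)) ^ 2 = ∑ i, (yhat i - f (x i)) ^ 2
      - 2 * ∑ i, ε i * (yhat i - f (x i)) + ∑ i, ε i ^ 2 := by
    rw [Finset.mul_sum, ← Finset.sum_sub_distrib, ← Finset.sum_add_distrib]
    exact Finset.sum_congr rfl fun i _ => by ring
  have e2 : ∑ i, (f (x i) - (f (x i) + ε i)) ^ 2 = ∑ i, ε i ^ 2 :=
    Finset.sum_congr rfl fun i _ => by ring
  rw [e1, e2, mul_add, mul_sub] at h0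
  linarith

lemma estimator_apply_data {n d : ℕ} {x : Fin n → Fin d → ℝ} {yhat : Fin n → ℝ}
    {a : Fin n → Fin d → ℝ} (h : Feasible x yhat a) (i : Fin n) :
    estimator x yhat a (x i) = yhat i := by
  have : Nonempty (Fin n) := ⟨i⟩
  apply le_antisymm
  · refine ciSup_le fun j => ?_
    have h1 := h j i
    have h2 : a j ⬝ᵥ (x i - x j) = -(a j ⬝ᵥ (x j - x i)) := by
      rw [← dotProduct_neg, neg_sub]
    linarith
  · refine le_trans ?_ (le_ciSup (Set.finite_range _).bddAbove i)
    simp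

lemma exists_subgradient_estimator {n d : ℕ} (hn : 0 < n) (x : Fin n → Fin d → ℝ)
    (yhat : Fin n → ℝ) (a : Fin n → Fin d → ℝ) (z : Fin d → ℝ) :
    ∃ p : Fin d → ℝ, ∑ l, |p l| ≤ slopeNorm a ∧
      ∀ w, estimator x yhat a z + p ⬝ᵥ (w - z) ≤ estimator x yhat a w := by
  have : Nonempty (Fin n) := ⟨⟨0, hn⟩⟩
  obtain ⟨i, hi⟩ := exists_eq_ciSup_of_finite (f := fun i => a i ⬝ᵥ (z - x i) + yhat i)
  refine ⟨a i, sum_abs_le_slopeNorm a i, fun w => ?_⟩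
  have h1 : a i ⬝ᵥ (w - x i) + yhat i ≤ estimator x yhat a w :=
    le_ciSup (f := fun i => a i ⬝ᵥ (w - x i) + yhat i) (Set.finite_range _).bddAbove i
  have h2 : a i ⬝ᵥ (w - x i) = a i ⬝ᵥ (z - x i) + a i ⬝ᵥ (w - z) := by
    rw [← dotProduct_add]
    congr 1
    abel
  rw [estimator, ← hi]
  linarith

/-- Functions bounded by `B` on the sup-norm ball of radius `R` that have, at each point of this
ball, a subgradient relative to the ball of `ℓ¹`-norm at most one. -/
structure UnitClass {d : ℕ} (R B : ℝ) (h : (Fin d → ℝ) → ℝ) : Prop where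
  bound : ∀ z, ‖z‖ ≤ R → |h z| ≤ B
  exists_subgradient : ∀ z, ‖z‖ ≤ R → ∃ p : Fin d → ℝ, ∑ l, |p l| ≤ 1 ∧
    ∀ w, ‖w‖ ≤ R → h z + p ⬝ᵥ (w - z) ≤ h w

lemma abs_estimator_le {n d : ℕ} (hn : 0 < n) {R Y : ℝ}
    {x : Fin n → Fin d → ℝ} {yhat : Fin n → ℝ} {a : Fin n → Fin d → ℝ} (h : Feasible x yhat a)
    (hx : ∀ i, ‖x i‖ ≤ R) (hY : ∃ i, |yhat i| ≤ Y) {z : Fin d → ℝ} (hz : ‖z‖ ≤ R) :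
    |estimator x yhat a z| ≤ Y + 2 * R * slopeNorm a := by
  obtain ⟨i, hi⟩ := hY
  have hdist : ‖z - x i‖ ≤ 2 * R := (norm_sub_le _ _).trans (by linarith [hx i])
  have hdist' : ‖x i - z‖ ≤ 2 * R := by rwa [norm_sub_rev]
  have key : ∀ p v : Fin d → ℝ, ∑ l, |p l| ≤ slopeNorm a → ‖v‖ ≤ 2 * R →
      |p ⬝ᵥ v| ≤ 2 * R * slopeNorm a := by
    intro p v hp hv
    refine (abs_dotProduct_le p v).trans ?_
    rw [mul_comm]
    exact mul_le_mul hv hp (Finset.sum_nonneg fun _ _ => abs_nonneg _) ((norm_nonneg _).trans hv)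
  obtain ⟨p, hp, hp'⟩ := exists_subgradient_estimator hn x yhat a z
  obtain ⟨q, hq, hq'⟩ := exists_subgradient_estimator hn x yhat a (x i)
  have h1 := hp' (x i)
  have h2 := hq' z
  rw [estimator_apply_data h] at h1 h2
  have h3 := abs_le.1 (key p _ hp hdist')
  have h4 := abs_le.1 (key q _ hq hdist)
  have h5 := abs_le.1 hi
  rw [abs_le]
  constructor <;> linarith

/-- Since `T ≥ 1` dominates the slopes, the bound `Y + 2 * R` is free of `T`, so one cover serves
every scale. -/
lemma unitClass_estimator {n d : ℕ} (hn : 0 < n) {R Y T : ℝ} (hR : 0 < R) (hT : 1 ≤ T)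
    {x : Fin n → Fin d → ℝ} {yhat : Fin n → ℝ} {a : Fin n → Fin d → ℝ} (h : Feasible x yhat a)
    (hx : ∀ i, ‖x i‖ ≤ R) (hY : ∃ i, |yhat i| ≤ Y) (haT : slopeNorm a ≤ T) :
    UnitClass R (Y + 2 * R) (fun z => T⁻¹ * estimator x yhat a z) := by
  have hT0 : 0 < T := by linarith
  constructor
  · intro z hz
    have h1 := abs_estimator_le hn h hx hY hz
    rw [abs_mul, abs_of_pos (inv_pos.2 hT0), inv_mul_le_iff₀ hT0]
    have hY0 : 0 ≤ Y := by
      obtain ⟨i, hi⟩ := hY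
      exact (abs_nonneg _).trans hi
    nlinarith
  · intro z _
    obtain ⟨p, hp, hp'⟩ := exists_subgradient_estimator hn x yhat a z
    refine ⟨T⁻¹ • p, ?_, fun w _ => ?_⟩
    · simp only [Pi.smul_apply, smul_eq_mul, abs_mul, abs_of_pos (inv_pos.2 hT0)]
      rw [← Finset.mul_sum, inv_mul_le_iff₀ hT0]
      linarith
    · rw [smul_dotProduct, smul_eq_mul, ← mul_add]
      exact mul_le_mul_of_nonneg_left (hp' w) (inv_pos.2 hT0).le

end ConvexAnalysis

/-! ### Sup-norm covers of `UnitClass` by rounded max-affine functions. -/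

section Covering

lemma sum_exp_neg_abs_div_le {W : ℝ} (hW : 0 < W) (t : Finset ℤ) :
    ∑ j ∈ t, Real.exp (-(|(j : ℝ)| / W)) ≤ 2 * (W + 1) := by
  set r := Real.exp (-(1 / W)) with hr
  have hr0 : 0 ≤ r := (Real.exp_pos _).le
  have hr1 : r ≤ W / (W + 1) := by
    have h1 : 1 / W + 1 ≤ Real.exp (1 / W) := Real.add_one_le_exp _
    rw [hr, Real.exp_neg, inv_le_comm₀ (Real.exp_pos _) (by positivity), inv_div]
    refine le_trans (le_of_eq ?_) h1
    field_simp
    ring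
  have hr2 : r < 1 := hr1.trans_lt ((div_lt_one (by positivity)).2 (by linarith))
  have hterm : ∀ j : ℤ, Real.exp (-(|(j : ℝ)| / W)) = r ^ j.natAbs := by
    intro j
    rw [hr, ← Real.exp_nat_mul, Nat.cast_natAbs, Int.cast_abs]
    congr 1
    ring
  have hgeo : ∀ s : Finset ℤ, Set.InjOn Int.natAbs (s : Set ℤ) →
      ∑ j ∈ s, r ^ j.natAbs ≤ W + 1 := by
    intro s hs
    rw [← Finset.sum_image (f := fun m => r ^ m) hs]
    refine ((summable_geometric_of_lt_one hr0 hr2).sum_le_tsum _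
      fun m _ => pow_nonneg hr0 m).trans ?_
    rw [tsum_geometric_of_lt_one hr0 hr2, inv_le_comm₀ (by linarith) (by positivity)]
    have h3 : W / (W + 1) = 1 - (W + 1)⁻¹ := by
      field_simp
      ring
    linarith
  simp only [hterm]
  rw [← Finset.sum_filter_add_sum_filter_not t (fun j => 0 ≤ j)]
  have h1 := hgeo (t.filter fun j => 0 ≤ j) (by
    intro i hi j hj hij
    simp only [Finset.coe_filter, Set.mem_ofPred_eq] at hi hj
    omega)
  have h2 := hgeo (t.filter fun j => ¬ 0 ≤ j) (by
    intro i hi j hj hij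
    simp only [Finset.coe_filter, Set.mem_ofPred_eq] at hi hj
    omega)
  linarith

/-- The number of integer points in an `ℓ¹`-ball whose radius is proportional to the dimension
grows at most exponentially with the dimension. -/
lemma card_int_le_of_sum_abs_le {d : ℕ} {W : ℝ} (hW : 0 < W) (s : Finset (Fin d → ℤ))
    (hs : ∀ k ∈ s, ∑ l, |(k l : ℝ)| ≤ d * W) : (s.card : ℝ) ≤ (6 * (W + 1)) ^ d := by
  classical
  let t : Fin d → Finset ℤ := fun l => s.image fun k => k l
  have hst : s ⊆ Fintype.piFinset t := fun k hk =>
    Fintype.mem_piFinset.2 fun l => Finset.mem_image_of_mem (fun k => k l) hk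
  calc (s.card : ℝ) = ∑ _k ∈ s, (1 : ℝ) := by simp
    -- Chernoff-style counting: each point of the `ℓ¹`-ball has weight `exp (d - ∑ |k l| / W) ≥ 1`,
    -- and the total weight over a box factorizes into `d` one-dimensional sums.
    _ ≤ ∑ k ∈ s, ∏ l, (Real.exp 1 * Real.exp (-(|(k l : ℝ)| / W))) := by
        refine Finset.sum_le_sum fun k hk => ?_
        simp only [← Real.exp_add]
        rw [← Real.exp_sum, Finset.sum_add_distrib, Finset.sum_neg_distrib, ← Finset.sum_div]
        apply Real.one_le_exp
        have : (∑ l, |(k l : ℝ)|) / W ≤ d := (div_le_iff₀ hW).2 (hs k hk)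
        simp
        linarith
    _ ≤ ∑ k ∈ Fintype.piFinset t, ∏ l, (Real.exp 1 * Real.exp (-(|(k l : ℝ)| / W))) :=
        Finset.sum_le_sum_of_subset_of_nonneg hst fun k _ _ => by positivity
    _ = ∏ l, ∑ j ∈ t l, (Real.exp 1 * Real.exp (-(|(j : ℝ)| / W))) := by
        rw [Finset.prod_univ_sum]
    _ ≤ ∏ _l : Fin d, (6 * (W + 1)) := by
        refine Finset.prod_le_prod (fun l _ => by positivity) fun l _ => ?_
        rw [← Finset.mul_sum]
        have h1 := sum_exp_neg_abs_div_le hW (t l)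
        have h2 : Real.exp 1 ≤ 3 := by linarith [Real.exp_one_lt_d9]
        have h3 : 0 < Real.exp 1 := Real.exp_pos 1
        calc _ ≤ 3 * (2 * (W + 1)) := by gcongr
          _ = _ := by ring
    _ = (6 * (W + 1)) ^ d := by simp

/-- In each coordinate `4 * d * u * v ≤ (u + d * v) ^ 2 < r ^ 2`, with `u`, `v` the differences of
points and slopes. The weight `d` makes the `d` errors sum to `r ^ 2 / 4`, and puts slopes of
`ℓ¹`-norm one on the same `ℓ¹` scale as points of sup norm `R`. -/
lemma dotProduct_le_of_floor_eq {d : ℕ} (hd : 0 < d) {r : ℝ} (hr : 0 < r)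
    {z w p q : Fin d → ℝ} (h : ∀ l, ⌊(z l + d * p l) / r⌋ = ⌊(w l + d * q l) / r⌋) :
    (p - q) ⬝ᵥ (z - w) ≤ r ^ 2 / 4 := by
  have hd' : (0 : ℝ) < d := by exact_mod_cast hd
  have h1 : ∀ l, (p l - q l) * (z l - w l) ≤ r ^ 2 / (4 * d) := by
    intro l
    have h2 := Int.abs_sub_lt_one_of_floor_eq_floor (h l)
    rw [← sub_div, abs_div, abs_of_pos hr, div_lt_one hr] at h2
    have h3 := sq_lt_sq' (by linarith [(abs_lt.1 h2).1]) (abs_lt.1 h2).2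
    rw [le_div_iff₀ (by positivity)]
    nlinarith [sq_nonneg ((z l - w l) - d * (p l - q l))]
  calc (p - q) ⬝ᵥ (z - w) = ∑ l, (p l - q l) * (z l - w l) := rfl
    _ ≤ ∑ _l : Fin d, r ^ 2 / (4 * d) := Finset.sum_le_sum fun l _ => h1 l
    _ = r ^ 2 / 4 := by
      simp
      field_simp

/-- The maximum of the affine functions, indexed by `κ`, whose
coefficients are the multiples of `η` given by `m`. -/
noncomputable def gridMaxAffine {d : ℕ} {κ : Type*} {I : Finset ℤ} (η : ℝ)
    (m : κ → Option (Fin d) → I) (w : Fin d → ℝ) : ℝ :=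
  ⨆ k, (∑ l, η * ((m k (some l) : ℤ) : ℝ) * w l + η * ((m k none : ℤ) : ℝ))

lemma measurable_gridMaxAffine {d : ℕ} {κ : Type*} [Countable κ] {I : Finset ℤ} (η : ℝ)
    (m : κ → Option (Fin d) → I) : Measurable (gridMaxAffine η m) := by
  unfold gridMaxAffine
  apply Measurable.iSup
  intro k
  fun_prop

lemma exists_grid_approx {κ σ : Type*} {η Y : ℝ} (hη : 0 < η) (b : κ → σ → ℝ)
    (hb : ∀ k s, |b k s| ≤ Y) :
    ∃ m : κ → σ → Finset.Icc (-⌈Y / η⌉) ⌈Y / η⌉, ∀ k s, |b k s - η * ((m k s : ℤ) : ℝ)| ≤ η := by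
  refine ⟨fun k s => ⟨⌊b k s / η⌋, ?_⟩, fun k s => ?_⟩
  · have h := abs_le.1 (hb k s)
    rw [Finset.mem_Icc]
    constructor
    · rw [← Int.floor_neg, ← neg_div]
      exact Int.floor_mono (by gcongr; exact h.1)
    · exact (Int.floor_le_ceil _).trans (Int.ceil_mono (by gcongr; exact h.2))
  · have h1 := Int.floor_le (b k s / η)
    have h2 := Int.lt_floor_add_one (b k s / η)
    rw [le_div_iff₀ hη] at h1
    rw [div_lt_iff₀ hη] at h2
    rw [abs_le]
    constructor <;> nlinarith

/-- The cells in which the vectors `z + d • p`, with `‖z‖ ≤ R` and `p` of `ℓ¹`-norm at most one,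
lie. -/
noncomputable def cells (d : ℕ) (R r : ℝ) : Finset (Fin d → ℤ) :=
  {k ∈ Fintype.piFinset fun _ : Fin d => Finset.Icc (-⌈d * (1 + (R + 1) / r)⌉)
    ⌈d * (1 + (R + 1) / r)⌉ | ∑ l, |(k l : ℝ)| ≤ d * (1 + (R + 1) / r)}

lemma card_cells_le {d : ℕ} {R r : ℝ} (hR : 0 < R) (hr : 0 < r) (hr1 : r ≤ 1) :
    ((cells d R r).card : ℝ) ≤ (6 * (R + 3) / r) ^ d := by
  have hW : 0 < 1 + (R + 1) / r := by positivity
  refine (card_int_le_of_sum_abs_le hW _ fun k hk => (Finset.mem_filter.1 hk).2).trans ?_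
  apply pow_le_pow_left₀ (by positivity)
  rw [mul_div_assoc]
  apply mul_le_mul_of_nonneg_left _ (by norm_num)
  rw [le_div_iff₀ hr, add_mul, add_mul, div_mul_cancel₀ _ hr.ne']
  linarith

lemma floor_mem_cells {d : ℕ} {R r : ℝ} (hr : 0 < r) {z p : Fin d → ℝ}
    (hz : ‖z‖ ≤ R) (hp : ∑ l, |p l| ≤ 1) : (fun l => ⌊(z l + d * p l) / r⌋) ∈ cells d R r := by
  have hsum : ∑ l, |((⌊(z l + d * p l) / r⌋ : ℤ) : ℝ)| ≤ d * (1 + (R + 1) / r) := by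
    have h1 : ∀ l, |((⌊(z l + d * p l) / r⌋ : ℤ) : ℝ)| ≤ 1 + (R + d * |p l|) / r := by
      intro l
      have h2 : |(z l + d * p l) / r| ≤ (R + d * |p l|) / r := by
        rw [abs_div, abs_of_pos hr]
        gcongr
        refine (abs_add_le _ _).trans (add_le_add ((norm_le_pi_norm z l).trans hz) ?_)
        rw [abs_mul, Nat.abs_cast]
      have h3 := Int.floor_le ((z l + d * p l) / r)
      have h4 := Int.lt_floor_add_one ((z l + d * p l) / r)
      have h5 := abs_le.1 h2
      rw [abs_le]
      constructor <;> linarith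
    refine (Finset.sum_le_sum fun l _ => h1 l).trans ?_
    rw [Finset.sum_add_distrib, ← Finset.sum_div, Finset.sum_add_distrib, ← Finset.mul_sum]
    simp only [Finset.sum_const, Finset.card_univ, Fintype.card_fin, nsmul_eq_mul, mul_one]
    rw [mul_add, mul_one, ← mul_div_assoc]
    gcongr
    nlinarith [Nat.cast_nonneg (α := ℝ) d]
  refine Finset.mem_filter.2 ⟨Fintype.mem_piFinset.2 fun l => ?_, hsum⟩
  have h1 := (Finset.single_le_sum (f := fun l => |((⌊(z l + d * p l) / r⌋ : ℤ) : ℝ)|)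
    (fun l _ => abs_nonneg _) (Finset.mem_univ l)).trans hsum
  have h2 := (abs_le.1 h1)
  have h3 := Int.le_ceil (d * (1 + (R + 1) / r))
  rw [Finset.mem_Icc]
  constructor
  · have : ((-⌈d * (1 + (R + 1) / r)⌉ : ℤ) : ℝ) ≤ ((⌊(z l + d * p l) / r⌋ : ℤ) : ℝ) := by
      push_cast
      linarith
    exact_mod_cast this
  · have : ((⌊(z l + d * p l) / r⌋ : ℤ) : ℝ) ≤ ((⌈d * (1 + (R + 1) / r)⌉ : ℤ) : ℝ) := by linarith
    exact_mod_cast this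

lemma UnitClass.exists_gridMaxAffine {d : ℕ} (hd : 0 < d) {R B r η : ℝ} (hR : 0 < R)
    (hB : 0 ≤ B) (hr : 0 < r) (hη : 0 < η) (hηr : η * (d * R + 1) ≤ r ^ 2 / 2)
    {h : (Fin d → ℝ) → ℝ} (hh : UnitClass R B h) :
    ∃ m : cells d R r → Option (Fin d) →
      Finset.Icc (-⌈(B + R + 1) / η⌉) ⌈(B + R + 1) / η⌉,
      ∀ z, ‖z‖ ≤ R → |h z - gridMaxAffine η m z| ≤ r ^ 2 := by
  choose! p hp1 hp2 using hh.exists_subgradient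
  let cell : (Fin d → ℝ) → Fin d → ℤ := fun z l => ⌊(z l + d * p z l) / r⌋
  have h0 : ‖(0 : Fin d → ℝ)‖ ≤ R := by simpa using hR.le
  -- Unoccupied cells get the representative `0`: its tangent is still a minorant of `h`, so
  -- including it in the maximum is harmless.
  have hpt : ∀ k : Fin d → ℤ, ∃ z : Fin d → ℝ, ‖z‖ ≤ R ∧
      ((∃ w, ‖w‖ ≤ R ∧ cell w = k) → cell z = k) := by
    intro k
    by_cases hk : ∃ w, ‖w‖ ≤ R ∧ cell w = k
    · obtain ⟨w, hw, hwk⟩ := hk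
      exact ⟨w, hw, fun _ => hwk⟩
    · exact ⟨0, h0, fun hk' => absurd hk' hk⟩
  choose c hc1 hc2 using hpt
  let b : cells d R r → Option (Fin d) → ℝ := fun k s =>
    s.elim (h (c k) - p (c k) ⬝ᵥ c k) (fun l => p (c k) l)
  have hb : ∀ k s, |b k s| ≤ B + R + 1 := by
    intro k s
    have hpk := hp1 (c k) (hc1 k)
    cases s with
    | none =>
      have h1 := abs_dotProduct_le (p (c k)) (c k)
      have h2 : (∑ l, |p (c k) l|) * ‖c k‖ ≤ 1 * R :=
        mul_le_mul hpk (hc1 k) (norm_nonneg _) zero_le_one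
      have h3 := hh.bound (c k) (hc1 k)
      have h4 := abs_sub (h (c k)) (p (c k) ⬝ᵥ c k)
      change |h (c k) - p (c k) ⬝ᵥ c k| ≤ _
      linarith
    | some l =>
      have h1 := Finset.single_le_sum (f := fun l => |p (c k) l|) (fun l _ => abs_nonneg _)
        (Finset.mem_univ l)
      change |p (c k) l| ≤ _
      linarith
  obtain ⟨m, hm⟩ := exists_grid_approx hη b hb
  refine ⟨m, fun z hz => ?_⟩
  have : Nonempty (cells d R r) := ⟨⟨_, floor_mem_cells hr h0 (hp1 0 h0)⟩⟩
  have hpiece : ∀ k : cells d R r, |(h (c k) + p (c k) ⬝ᵥ (z - c k)) -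
      (∑ l, η * ((m k (some l) : ℤ) : ℝ) * z l + η * ((m k none : ℤ) : ℝ))| ≤ r ^ 2 / 2 := by
    intro k
    have e : (h (c k) + p (c k) ⬝ᵥ (z - c k)) -
        (∑ l, η * ((m k (some l) : ℤ) : ℝ) * z l + η * ((m k none : ℤ) : ℝ))
        = (fun l => b k (some l) - η * ((m k (some l) : ℤ) : ℝ)) ⬝ᵥ z
          + (b k none - η * ((m k none : ℤ) : ℝ)) := by
      have e1 : (fun l => b k (some l) - η * ((m k (some l) : ℤ) : ℝ)) ⬝ᵥ z
          = p (c k) ⬝ᵥ z - ∑ l, η * ((m k (some l) : ℤ) : ℝ) * z l := by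
        simp only [dotProduct, sub_mul, Finset.sum_sub_distrib]
        rfl
      have e2 : b k none = h (c k) - p (c k) ⬝ᵥ c k := rfl
      rw [e1, e2, dotProduct_sub]
      ring
    rw [e]
    have h1 := abs_dotProduct_le (fun l => b k (some l) - η * ((m k (some l) : ℤ) : ℝ)) z
    have h2 : ∑ l, |b k (some l) - η * ((m k (some l) : ℤ) : ℝ)| ≤ d * η := by
      simpa using Finset.sum_le_card_nsmul Finset.univ _ η fun l _ => hm k (some l)
    have h3 : (∑ l, |b k (some l) - η * ((m k (some l) : ℤ) : ℝ)|) * ‖z‖ ≤ d * η * R :=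
      mul_le_mul h2 hz (norm_nonneg _) (by positivity)
    refine (abs_add_le _ _).trans ?_
    have h4 := hm k none
    linarith
  have hbdd : BddAbove (Set.range fun k : cells d R r =>
      ∑ l, η * ((m k (some l) : ℤ) : ℝ) * z l + η * ((m k none : ℤ) : ℝ)) :=
    (Set.finite_range _).bddAbove
  have hr2 : 0 ≤ r ^ 2 := sq_nonneg r
  rw [abs_le]
  constructor
  -- Every tangent lies below `h`, so only rounding contributes.
  · have hupper : gridMaxAffine η m z ≤ h z + r ^ 2 / 2 := by
      refine ciSup_le fun k => ?_
      have h1 := (abs_le.1 (hpiece k)).1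
      have h2 := hp2 (c k) (hc1 k) z hz
      linarith
    linarith
  -- The tangent at the representative of the cell of `z` loses at most `(p z - p (c k)) ⬝ᵥ (z - c
  -- k) ≤ r ^ 2 / 4`, by the subgradient inequality at `z`.
  · let k : cells d R r := ⟨cell z, floor_mem_cells hr hz (hp1 z hz)⟩
    have hk : cell (c k) = cell z := hc2 k ⟨z, hz, rfl⟩
    have h1 : (p z - p (c k)) ⬝ᵥ (z - c k) ≤ r ^ 2 / 4 :=
      dotProduct_le_of_floor_eq hd hr fun l => (congrFun hk l).symm
    have h2 := hp2 z hz (c k) (hc1 k)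
    have h3 := (abs_le.1 (hpiece k)).2
    have h4 := le_ciSup hbdd k
    have h5 : (p z - p (c k)) ⬝ᵥ (z - c k)
        = -(p z ⬝ᵥ (c k - z)) - p (c k) ⬝ᵥ (z - c k) := by
      rw [sub_dotProduct, ← dotProduct_neg, neg_sub]
    have h6 : gridMaxAffine η m z = ⨆ k : cells d R r,
      (∑ l, η * ((m k (some l) : ℤ) : ℝ) * z l + η * ((m k none : ℤ) : ℝ)) := rfl
    linarith

/-- Covering numbers of `UnitClass` in the sup norm, with constants uniform in the dimension. -/
theorem exists_cover_unitClass {d : ℕ} (hd : 0 < d) {R B r : ℝ} (hR : 0 < R) (hB : 0 ≤ B)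
    (hr : 0 < r) (hr1 : r ≤ 1) :
    ∃ J : Finset ((Fin d → ℝ) → ℝ),
      (J.card : ℝ) ≤ Real.exp ((6 * (R + 3) / r) ^ d * (d + 1) *
        Real.log (4 * (B + R + 1) * (d * R + 1) / r ^ 2 + 3)) ∧
      (∀ g ∈ J, Measurable g ∧ ∀ z, ‖z‖ ≤ R → |g z| ≤ B + 1) ∧
      ∀ h, UnitClass R B h → ∃ g ∈ J, ∀ z, ‖z‖ ≤ R → |h z - g z| ≤ r ^ 2 := by
  classical
  set η := r ^ 2 / (2 * (d * R + 1)) with hη_def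
  have hη : 0 < η := by positivity
  have hηr : η * (d * R + 1) ≤ r ^ 2 / 2 := by
    rw [hη_def]
    apply le_of_eq
    field_simp
  set N := ⌈(B + R + 1) / η⌉ with hN
  have hN0 : 0 ≤ N := Int.ceil_nonneg (by positivity)
  let F : (cells d R r → Option (Fin d) → Finset.Icc (-N) N) → (Fin d → ℝ) → ℝ :=
    fun m => gridMaxAffine η m
  -- Discarding grid functions far from the class makes the remaining ones bounded by `B + r ^ 2 ≤ B
  -- + 1`, as Hoeffding's inequality requires.
  refine ⟨{g ∈ Finset.univ.image F | ∃ h, UnitClass R B h ∧ ∀ z, ‖z‖ ≤ R → |h z - g z| ≤ r ^ 2},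
    ?_, ?_, ?_⟩
  · set q := 4 * (B + R + 1) * (d * R + 1) / r ^ 2 + 3 with hq
    have hq1 : 1 ≤ q := by
      have : 0 ≤ 4 * (B + R + 1) * (d * R + 1) / r ^ 2 := by positivity
      linarith
    have hcard : ((Finset.Icc (-N) N).card : ℝ) ≤ q := by
      have h1 : ((Finset.Icc (-N) N).card : ℤ) = 2 * N + 1 := by
        rw [Int.card_Icc]
        omega
      have h2 : ((Finset.Icc (-N) N).card : ℝ) = 2 * N + 1 := by exact_mod_cast h1
      have h3 := Int.ceil_lt_add_one ((B + R + 1) / η)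
      rw [← hN] at h3
      have h4 : 2 * ((B + R + 1) / η) = 4 * (B + R + 1) * (d * R + 1) / r ^ 2 := by
        rw [hη_def]
        field_simp
        ring
      rw [h2]
      linarith
    calc _ ≤ ((Finset.univ.image F).card : ℝ) := by
          exact_mod_cast Finset.card_le_card (Finset.filter_subset _ _)
      _ ≤ (Fintype.card (cells d R r → Option (Fin d) → Finset.Icc (-N) N) : ℝ) := by
          exact_mod_cast Finset.card_image_le
      _ = (((Finset.Icc (-N) N).card : ℝ) ^ (d + 1)) ^ (cells d R r).card := by
          simp
      _ ≤ (q ^ (d + 1)) ^ (cells d R r).card := by gcongr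
      _ = Real.exp ((cells d R r).card * (d + 1) * Real.log q) := by
          rw [← pow_mul, ← Real.rpow_natCast, Real.rpow_def_of_pos (by linarith)]
          push_cast
          ring_nf
      _ ≤ _ := by
          apply Real.exp_le_exp.2
          have := Real.log_nonneg hq1
          gcongr
          exact card_cells_le hR hr hr1
  · intro g hg
    obtain ⟨hg1, h, hh, hgh⟩ := Finset.mem_filter.1 hg
    obtain ⟨m, -, rfl⟩ := Finset.mem_image.1 hg1
    refine ⟨measurable_gridMaxAffine η m, fun z hz => ?_⟩
    have h1 := abs_le.1 (hgh z hz)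
    have h2 := abs_le.1 (hh.bound z hz)
    have h3 : r ^ 2 ≤ 1 := pow_le_one₀ hr.le hr1
    rw [abs_le]
    constructor <;> linarith
  · intro h hh
    obtain ⟨m, hm⟩ := hh.exists_gridMaxAffine hd hR hB hr hη hηr
    exact ⟨F m, Finset.mem_filter.2 ⟨Finset.mem_image_of_mem F (Finset.mem_univ m), h, hh, hm⟩, hm⟩

end Covering

/-! ### Balancing the cover against the rate. -/

section RateArithmetic

/-- The bound on the covering number of `UnitClass` at scale `e` in the sup norm. -/
noncomputable def coverBound (d : ℕ) (R B e : ℝ) : ℝ :=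
  Real.exp ((6 * (R + 3) / √e) ^ d * (d + 1) *
    Real.log (4 * (B + R + 1) * (d * R + 1) / e + 3))

/-- With `ℓ = log (n / d)` and `ρ = exp (-2 * ℓ / (d + 4))`, accuracy `Q ^ 2 * ρ` turns the cell
count into `exp (ℓ * d / (d + 4)) = exp ℓ * ρ ^ 2`; for large `ℓ` the logarithm is at most `2 * ℓ`.
Then `d * exp ℓ = n` makes the bound `4 * ℓ * n * ρ ^ 2`. -/
lemma log_coverBound_le {d : ℕ} (hd : 1 ≤ d) {R B Γ ℓ : ℝ} (hR : 0 < R) (hB : 0 ≤ B)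
    (hΓ : 4 * (B + R + 1) * (R + 1) + 3 ≤ Γ) (hℓ : Γ * (d + 4) ≤ ℓ) :
    (6 * (R + 3) / √((6 * (R + 3)) ^ 2 * Real.exp (-(2 * ℓ / (d + 4))))) ^ d * (d + 1) *
      Real.log (4 * (B + R + 1) * (d * R + 1) /
        ((6 * (R + 3)) ^ 2 * Real.exp (-(2 * ℓ / (d + 4)))) + 3)
      ≤ 4 * ℓ * (d * Real.exp ℓ) * Real.exp (-(2 * ℓ / (d + 4))) ^ 2 := by
  have hd' : (1 : ℝ) ≤ d := by exact_mod_cast hd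
  set Q := 6 * (R + 3) with hQ
  set ρ := Real.exp (-(2 * ℓ / (d + 4))) with hρ
  have hρ0 : 0 < ρ := Real.exp_pos _
  have hQ1 : 1 ≤ Q := by linarith
  have hΓ1 : 1 ≤ Γ := by
    have : 0 ≤ 4 * (B + R + 1) * (R + 1) := by positivity
    linarith
  have hℓΓ : 5 * Γ ≤ ℓ := by nlinarith
  have hℓd : (d : ℝ) ≤ ℓ := by nlinarith
  have hρ1 : ρ ≤ 1 := Real.exp_le_one_iff.2 (by
    have : 0 ≤ 2 * ℓ / (d + 4) := by apply div_nonneg <;> linarith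
    linarith)
  have hfrac : 2 * ℓ / (d + 4) ≤ 2 * ℓ / 5 := by
    apply div_le_div_of_nonneg_left <;> linarith
  have hpow : (Q / √(Q ^ 2 * ρ)) ^ d = Real.exp (ℓ * d / (d + 4)) := by
    have h1 : √(Q ^ 2 * ρ) = Q * Real.exp (-(ℓ / (d + 4))) := by
      rw [Real.sqrt_mul (sq_nonneg Q), Real.sqrt_sq (by linarith), hρ, ← Real.exp_half]
      congr 2
      ring
    rw [h1, Real.exp_neg]
    have h2 : Q / (Q * (Real.exp (ℓ / (d + 4)))⁻¹) = Real.exp (ℓ / (d + 4)) := by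
      field_simp
    rw [h2, ← Real.exp_nat_mul]
    congr 1
    ring
  have hlog : Real.log (4 * (B + R + 1) * (d * R + 1) / (Q ^ 2 * ρ) + 3) ≤ 2 * ℓ := by
    have h1 : 4 * (B + R + 1) * (d * R + 1) / (Q ^ 2 * ρ) + 3
        ≤ (4 * (B + R + 1) * (R + 1) + 3) * d / ρ := by
      have h2 : 4 * (B + R + 1) * (d * R + 1) / (Q ^ 2 * ρ)
          ≤ 4 * (B + R + 1) * ((R + 1) * d) / ρ := by
        apply div_le_div₀ (by positivity) _ hρ0 _
        · gcongr
          nlinarith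
        · exact le_mul_of_one_le_left hρ0.le (one_le_pow₀ hQ1)
      have h3 : 3 ≤ 3 * d / ρ := by
        rw [le_div_iff₀ hρ0]
        nlinarith
      refine (add_le_add h2 h3).trans (le_of_eq ?_)
      ring
    refine (Real.log_le_log (by positivity) h1).trans ?_
    have h4 : 0 < 4 * (B + R + 1) * (R + 1) + 3 := by positivity
    rw [Real.log_div (by positivity) hρ0.ne', Real.log_mul h4.ne' (by positivity), hρ, Real.log_exp]
    have h5 := (Real.log_le_self h4.le).trans hΓ
    have h6 := Real.log_le_self (by linarith : (0 : ℝ) ≤ d)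
    linarith
  have hexp : Real.exp (ℓ * d / (d + 4)) = Real.exp ℓ * ρ ^ 2 := by
    rw [hρ, ← Real.exp_nat_mul, ← Real.exp_add]
    congr 1
    field_simp
    push_cast
    ring
  rw [hpow, hexp]
  have hℓ0 : 0 ≤ ℓ := by linarith
  have hlog0 : 0 ≤ Real.log (4 * (B + R + 1) * (d * R + 1) / (Q ^ 2 * ρ) + 3) := by
    apply Real.log_nonneg
    have : 0 ≤ 4 * (B + R + 1) * (d * R + 1) / (Q ^ 2 * ρ) := by positivity
    linarith
  calc _ ≤ Real.exp ℓ * ρ ^ 2 * (2 * d) * (2 * ℓ) := by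
        gcongr
        linarith
    _ = _ := by ring

set_option maxHeartbeats 800000 in
theorem exists_rate_threshold {M R : ℝ} (hM : 0 < M) (hR : 0 < R) :
    ∃ c : ℝ, 0 < c ∧ c ≤ 1 ∧ ∀ (n d : ℕ) (δ : ℝ), 1 ≤ d → d ≤ n → 0 < δ → δ < 1 →
      rate n d δ < c → ∃ e : ℝ, 0 < e ∧ e ≤ 1 ∧ e ≤ rate n d δ ∧ 6 * M * e ≤ rate n d δ ∧
        e * (4 * M ^ 2 / rate n d δ + 1) ≤ M ∧
        2 * (4 * M ^ 2 / rate n d δ + 1) * coverBound d R (4 * M + 2 * R) e *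
          Real.exp (-(8 * n * rate n d δ ^ 2)) ≤ δ := by
  set Q := 6 * (R + 3) with hQ
  set B := 4 * M + 2 * R with hB
  -- A sum of positive terms, so that `Γ` dominates each constant needed below.
  set Γ := 2 + Q ^ 2 + 8 * M * Q ^ 2 + Q ^ 2 / M + 4 * M ^ 2
    + (4 * (B + R + 1) * (R + 1) + 3) with hΓ
  have hB0 : 0 < B := by positivity
  have hQ0 : 0 < Q := by positivity
  have p1 : 0 < Q ^ 2 := by positivity
  have p2 : 0 < 8 * M * Q ^ 2 := by positivity
  have p3 : 0 < Q ^ 2 / M := by positivity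
  have p4 : 0 < 4 * M ^ 2 := by positivity
  have p5 : 0 < 4 * (B + R + 1) * (R + 1) + 3 := by positivity
  have hΓ0 : 0 < Γ := by linarith
  have g1 : Q ^ 2 ≤ Γ := by linarith
  have g2 : 8 * M * Q ^ 2 ≤ Γ := by linarith
  have g3 : Q ^ 2 / M ≤ Γ := by linarith
  have g4 : 4 * M ^ 2 + 1 ≤ Γ := by linarith
  have g5 : 4 * (B + R + 1) * (R + 1) + 3 ≤ Γ := by linarith
  have g6 : 1 ≤ Γ := by linarith
  clear_value Γ
  refine ⟨Real.exp (-(2 * Γ)), Real.exp_pos _, Real.exp_le_one_iff.2 (by linarith), ?_⟩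
  intro n d δ hd hdn hδ hδ1 hsmall
  have hd' : (1 : ℝ) ≤ d := by exact_mod_cast hd
  have hn' : (1 : ℝ) ≤ n := by exact_mod_cast hd.trans hdn
  have hν : 0 < (n : ℝ) / d := by positivity
  set ℓ := Real.log ((n : ℝ) / d) with hℓ
  set ρ := Real.exp (-(2 * ℓ / (d + 4))) with hρ
  set τ := √(Real.log (1 / δ) / n) with hτ
  have hρ0 : 0 < ρ := Real.exp_pos _
  have hτ0 : 0 ≤ τ := Real.sqrt_nonneg _
  have hrate : rate n d δ = ρ * max 1 ℓ + τ := by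
    rw [rate, Real.rpow_def_of_pos hν, hρ]
    congr 3
    ring
  set lam := rate n d δ with hlam
  have hρlam : ρ ≤ lam := by
    rw [hrate]
    have := le_max_left 1 ℓ
    nlinarith
  -- A small rate forces `n / d` to be exponentially large in `d`, which keeps all constants
  -- independent of the dimension.
  have hℓΓ : Γ * (d + 4) ≤ ℓ := by
    have h1 := Real.exp_lt_exp.1 (hρlam.trans_lt hsmall)
    have h2 : Γ < ℓ / (d + 4) := by
      rw [mul_div_assoc] at h1
      linarith
    exact ((lt_div_iff₀ (by linarith)).1 h2).le
  have hℓ5 : 5 * Γ ≤ ℓ := by nlinarith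
  have hℓ1 : 1 ≤ ℓ := by linarith
  have hρΓ : ρ * (2 * Γ) ≤ 1 := by
    have h1 : ρ ≤ Real.exp (-(2 * Γ)) := (hρlam.trans_lt hsmall).le
    have h2 : 2 * Γ ≤ Real.exp (2 * Γ) := by linarith [Real.add_one_le_exp (2 * Γ)]
    calc ρ * (2 * Γ) ≤ Real.exp (-(2 * Γ)) * Real.exp (2 * Γ) := by gcongr
      _ = 1 := by rw [← Real.exp_add]; simp
  have hρ1 : ρ ≤ 1 := by nlinarith
  have hlamℓ : lam = ρ * ℓ + τ := by rw [hrate, max_eq_right hℓ1]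
  have hlam0 : 0 < lam := hρ0.trans_le hρlam
  have hρℓ : ρ * ℓ ≤ lam := by linarith
  refine ⟨Q ^ 2 * ρ, by positivity, ?_, ?_, ?_, ?_, ?_⟩
  · calc Q ^ 2 * ρ ≤ (2 * Γ) * ρ := by gcongr; linarith
      _ ≤ 1 := by linarith
  · calc Q ^ 2 * ρ ≤ ℓ * ρ := by gcongr; linarith
      _ ≤ lam := by linarith
  · have h2 : 8 * M * Q ^ 2 * ρ ≤ ℓ * ρ := by gcongr; linarith
    have h3 : 0 ≤ M * Q ^ 2 * ρ := by positivity
    linarith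
  · have h1 : Q ^ 2 * ρ * (4 * M ^ 2 / lam) ≤ M / 2 := by
      rw [← mul_div_assoc, div_le_iff₀ hlam0]
      have h2 : 8 * M * Q ^ 2 * ρ ≤ ℓ * ρ := by gcongr; linarith
      have h3 : M / 2 * (8 * M * Q ^ 2 * ρ) ≤ M / 2 * lam := by
        gcongr
        linarith
      linarith
    have h3 : Q ^ 2 * ρ ≤ M / 2 := by
      have h4 : Q ^ 2 / M * (2 * ρ) ≤ 1 := by
        calc Q ^ 2 / M * (2 * ρ) ≤ Γ * (2 * ρ) := by gcongr
          _ ≤ 1 := by linarith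
      have h5 : Q ^ 2 / M * (2 * ρ) = Q ^ 2 * ρ * 2 / M := by ring
      rw [h5, div_le_one hM] at h4
      linarith
    linarith
  · have hcov : coverBound d R B (Q ^ 2 * ρ) ≤ Real.exp (4 * ℓ * n * ρ ^ 2) := by
      apply Real.exp_le_exp.2
      have h1 := log_coverBound_le (B := B) (Γ := Γ) (ℓ := ℓ) hd hR hB0.le g5 hℓΓ
      have h2 : (d : ℝ) * Real.exp ℓ = n := by
        rw [hℓ, Real.exp_log hν]
        field_simp
      rwa [h2] at h1
    have hm : 4 * M ^ 2 / lam + 1 ≤ Real.exp ℓ := by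
      have h1 : 4 * M ^ 2 / lam + 1 ≤ (4 * M ^ 2 + 1) / ρ := by
        rw [add_div]
        apply add_le_add
        · gcongr
        · rw [le_div_iff₀ hρ0]
          linarith
      have h2 : 4 * M ^ 2 + 1 ≤ Real.exp Γ := by
        have := Real.add_one_le_exp Γ
        linarith
      have h3 : (4 * M ^ 2 + 1) / ρ ≤ Real.exp Γ / ρ := by gcongr
      refine (h1.trans h3).trans ?_
      rw [hρ, ← Real.exp_sub]
      apply Real.exp_le_exp.2
      have hfrac : 2 * ℓ / (d + 4) ≤ 2 * ℓ / 5 := by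
        apply div_le_div_of_nonneg_left <;> linarith
      linarith
    have h2 : (2 : ℝ) ≤ Real.exp ℓ := by linarith [Real.add_one_le_exp ℓ]
    have hnρ : 1 ≤ n * ρ ^ 2 := by
      have h3 : (d : ℝ) / n ≤ ρ ^ 2 := by
        have h4 : (d : ℝ) / n = Real.exp (-ℓ) := by
          rw [hℓ, Real.exp_neg, Real.exp_log hν, inv_div]
        rw [h4, hρ, ← Real.exp_nat_mul]
        apply Real.exp_le_exp.2
        have h5 : 2 * (2 * ℓ / (d + 4)) ≤ ℓ := by
          rw [← mul_div_assoc, div_le_iff₀ (by linarith)]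
          nlinarith
        push_cast
        linarith
      rw [div_le_iff₀ (by linarith)] at h3
      linarith
    have hτ2 : n * τ ^ 2 = Real.log (1 / δ) := by
      have h6 : 0 ≤ Real.log (1 / δ) := Real.log_nonneg (by
        rw [le_div_iff₀ hδ]
        linarith)
      rw [hτ, Real.sq_sqrt (by positivity)]
      field_simp
    calc _ ≤ Real.exp ℓ * Real.exp ℓ * Real.exp (4 * ℓ * n * ρ ^ 2) *
          Real.exp (-(8 * n * lam ^ 2)) := by
          have : 0 ≤ 4 * M ^ 2 / lam + 1 := by positivity
          have h0 : 0 ≤ coverBound d R B (Q ^ 2 * ρ) := (Real.exp_pos _).le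
          gcongr
      _ = Real.exp (ℓ + ℓ + 4 * ℓ * n * ρ ^ 2 + -(8 * n * lam ^ 2)) := by
          simp only [Real.exp_add]
      -- As `n * ρ ^ 2 ≥ 1` and `ℓ ≥ 1`, the positive terms are at most `6 * n * ρ ^ 2 * ℓ ^ 2`.
      -- Since `lam = ρ * ℓ + τ`, the tail outweighs them and leaves at least `n * τ ^ 2 = log (1 /
      -- δ)`.
      _ ≤ Real.exp (Real.log δ) := by
          apply Real.exp_le_exp.2
          have e1 : Real.log δ = -(n * τ ^ 2) := by
            rw [hτ2, one_div, Real.log_inv, neg_neg]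
          have e2 : ℓ ≤ n * ρ ^ 2 * ℓ := le_mul_of_one_le_left (by linarith) hnρ
          have e3 : n * ρ ^ 2 * ℓ ≤ n * ρ ^ 2 * ℓ ^ 2 := by
            have h7 : ℓ ≤ ℓ ^ 2 := le_self_pow₀ hℓ1 two_ne_zero
            exact mul_le_mul_of_nonneg_left h7 (by positivity)
          have e4 : n * (ρ ^ 2 * ℓ ^ 2 + τ ^ 2) ≤ n * lam ^ 2 := by
            rw [hlamℓ]
            have h7 : 0 ≤ ρ * ℓ * τ := mul_nonneg (mul_nonneg hρ0.le (by linarith)) hτ0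
            apply mul_le_mul_of_nonneg_left _ (by linarith)
            linarith [add_sq (ρ * ℓ) τ, mul_pow ρ ℓ 2]
          have e5 : 0 ≤ n * τ ^ 2 := by positivity
          have e6 : 0 ≤ n * ρ ^ 2 * ℓ ^ 2 := by positivity
          rw [e1]
          linarith
      _ = δ := Real.exp_log hδ

end RateArithmetic

/-! ### Deterministic risk bounds on the good event. -/

section RiskBounds

lemma ae_mem_of_measure_compl_eq_zero {d : ℕ} {Ω : Set (Fin d → ℝ)} {P : Measure (Fin d → ℝ)}
    (hP : P Ωᶜ = 0) : ∀ᵐ z ∂P, z ∈ Ω := hP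

lemma excessRisk_le_of_abs_sub_le {d : ℕ} {Ω : Set (Fin d → ℝ)} {P : Measure (Fin d → ℝ)}
    [IsProbabilityMeasure P] (hP : P Ωᶜ = 0) {f g : (Fin d → ℝ) → ℝ} {D : ℝ}
    (h : ∀ z ∈ Ω, |f z - g z| ≤ D) : excessRisk P f g ≤ ENNReal.ofReal (D ^ 2) := by
  calc excessRisk P f g ≤ ∫⁻ _, ENNReal.ofReal (D ^ 2) ∂P := by
        apply lintegral_mono_ae
        filter_upwards [ae_mem_of_measure_compl_eq_zero hP] with z hz
        exact ENNReal.ofReal_le_ofReal (pow_le_pow_left₀ (abs_nonneg _) (h z hz) 2)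
    _ = _ := by simp

/-- The basic inequality with the noise term controlled through an approximation `T * g` of the
estimator. -/
lemma IsSolution.empirical_bound {n d : ℕ} (hn : 0 < n) {M L R lam e t T : ℝ}
    (hlam : 0 < lam) (hT : 0 < T)
    {x p : Fin n → Fin d → ℝ} {ε yhat : Fin n → ℝ} {a : Fin n → Fin d → ℝ}
    {f g : (Fin d → ℝ) → ℝ}
    (h : IsSolution lam x (fun i => f (x i) + ε i) yhat a)
    (hx : ∀ i, ‖x i‖ ≤ R) (hε : ∀ i, |ε i| ≤ M)
    (hp : ∀ i, p i ∈ subdifferential f (x i)) (hpL : slopeNorm p ≤ L)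
    (hg : ∀ z, ‖z‖ ≤ R → |T⁻¹ * estimator x yhat a z - g z| ≤ e)
    (hnoise : ∑ i, ε i * (T * g (x i) - f (x i)) ≤ (∑ i, (T * g (x i) - f (x i)) ^ 2) / 8 + t) :
    (1 / (n : ℝ)) * ∑ i, (yhat i - f (x i)) ^ 2 / 2 + lam * slopeNorm a
      ≤ lam * L + (T * e) ^ 2 / 2 + 2 * (t / n) + 2 * M * (T * e) := by
  have hn' : (0 : ℝ) < n := by exact_mod_cast hn
  have hclose : ∀ i, |yhat i - T * g (x i)| ≤ T * e := by
    intro i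
    have h1 := hg (x i) (hx i)
    rw [estimator_apply_data h.1] at h1
    have h2 : yhat i - T * g (x i) = T * (T⁻¹ * yhat i - g (x i)) := by field_simp
    rw [h2, abs_mul, abs_of_pos hT]
    gcongr
  have h1 : ∑ i, ε i * (yhat i - f (x i))
      ≤ ∑ i, ε i * (T * g (x i) - f (x i)) + n * (M * (T * e)) := by
    have : ∀ i ∈ Finset.univ, ε i * (yhat i - f (x i))
        ≤ ε i * (T * g (x i) - f (x i)) + M * (T * e) := by
      intro i _
      have h2 : ε i * (yhat i - T * g (x i)) ≤ M * (T * e) := by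
        refine (le_abs_self _).trans ?_
        rw [abs_mul]
        exact mul_le_mul (hε i) (hclose i) (abs_nonneg _) ((abs_nonneg _).trans (hε i))
      linarith
    refine (Finset.sum_le_sum this).trans (le_of_eq ?_)
    simp [Finset.sum_add_distrib]
  have h2 : ∑ i, (T * g (x i) - f (x i)) ^ 2
      ≤ 2 * ∑ i, (yhat i - f (x i)) ^ 2 + n * (2 * (T * e) ^ 2) := by
    have : ∀ i ∈ Finset.univ, (T * g (x i) - f (x i)) ^ 2
        ≤ 2 * (yhat i - f (x i)) ^ 2 + 2 * (T * e) ^ 2 := by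
      intro i _
      have h3 : (yhat i - T * g (x i)) ^ 2 ≤ (T * e) ^ 2 :=
        sq_le_sq' (abs_le.1 (hclose i)).1 (abs_le.1 (hclose i)).2
      nlinarith [sq_nonneg ((yhat i - f (x i)) + (yhat i - T * g (x i)))]
    refine (Finset.sum_le_sum this).trans (le_of_eq ?_)
    simp [Finset.sum_add_distrib, Finset.mul_sum]
  have h3 := h.basic_inequality hp
  set A := ∑ i, (yhat i - f (x i)) ^ 2 with hA
  -- Replacing `T * g` by the fit doubles the offset `1 / 8` to `1 / 4`; the factor `2` of the basic
  -- inequality makes it `1 / 2`, so half the squared error survives.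
  have h4 : ∑ i, ε i * (yhat i - f (x i))
      ≤ A / 4 + n * (T * e) ^ 2 / 4 + t + n * (M * (T * e)) := by linarith
  have h5 : (1 / (n : ℝ)) * ∑ i, ε i * (yhat i - f (x i))
      ≤ (1 / (n : ℝ)) * A / 4 + (T * e) ^ 2 / 4 + t / n + M * (T * e) := by
    have := mul_le_mul_of_nonneg_left h4 (by positivity : (0 : ℝ) ≤ 1 / (n : ℝ))
    refine this.trans (le_of_eq ?_)
    field_simp
  have h6 : lam * slopeNorm p ≤ lam * L := mul_le_mul_of_nonneg_left hpL hlam.le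
  rw [← Finset.sum_div, ← hA]
  linarith

/-- Transfer of an empirical bound on the risk to the population. -/
lemma excessRisk_le_of_empirical {n d : ℕ} (hn : 0 < n) {M R e u B T : ℝ}
    (hT : 0 < T) {Ω : Set (Fin d → ℝ)} (hΩ : ∀ z ∈ Ω, ‖z‖ ≤ R)
    {P : Measure (Fin d → ℝ)} [IsProbabilityMeasure P] (hP : P Ωᶜ = 0)
    {x : Fin n → Fin d → ℝ} {yhat : Fin n → ℝ} {a : Fin n → Fin d → ℝ}
    {f g : (Fin d → ℝ) → ℝ} (hf : Measurable f) (hfM : ∀ z ∈ Ω, |f z| ≤ M) (hgm : Measurable g)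
    (hgB : ∀ z, ‖z‖ ≤ R → |g z| ≤ B) (hfeas : Feasible x yhat a) (hx : ∀ i, ‖x i‖ ≤ R)
    (hg : ∀ z, ‖z‖ ≤ R → |T⁻¹ * estimator x yhat a z - g z| ≤ e)
    (hdev : n * (∫ z, (T * g z - f z) ^ 2 ∂P - u) ≤ ∑ i, (T * g (x i) - f (x i)) ^ 2) :
    excessRisk P f (estimator x yhat a) ≤ ENNReal.ofReal
      (4 * ((1 / (n : ℝ)) * ∑ i, (yhat i - f (x i)) ^ 2) + 6 * (T * e) ^ 2 + 2 * u) := by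
  have hn' : (0 : ℝ) < n := by exact_mod_cast hn
  have hclose : ∀ z, ‖z‖ ≤ R → (estimator x yhat a z - T * g z) ^ 2 ≤ (T * e) ^ 2 := by
    intro z hz
    have h2 : estimator x yhat a z - T * g z = T * (T⁻¹ * estimator x yhat a z - g z) := by
      field_simp
    have h3 : |estimator x yhat a z - T * g z| ≤ T * e := by
      rw [h2, abs_mul, abs_of_pos hT]
      exact mul_le_mul_of_nonneg_left (hg z hz) hT.le
    exact sq_le_sq' (abs_le.1 h3).1 (abs_le.1 h3).2
  have hint : Integrable (fun z => (T * g z - f z) ^ 2) P := by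
    refine Integrable.of_bound (by fun_prop) ((T * B + M) ^ 2) ?_
    filter_upwards [ae_mem_of_measure_compl_eq_zero hP] with z hz
    rw [Real.norm_eq_abs, abs_pow]
    refine pow_le_pow_left₀ (abs_nonneg _) ((abs_sub _ _).trans (add_le_add ?_ (hfM z hz))) 2
    rw [abs_mul, abs_of_pos hT]
    exact mul_le_mul_of_nonneg_left (hgB z (hΩ z hz)) hT.le
  have h1 : excessRisk P f (estimator x yhat a)
      ≤ ENNReal.ofReal (2 * ∫ z, (T * g z - f z) ^ 2 ∂P + 2 * (T * e) ^ 2) := by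
    have h2 : ∫ z, (2 * (T * g z - f z) ^ 2 + 2 * (T * e) ^ 2) ∂P
        = 2 * ∫ z, (T * g z - f z) ^ 2 ∂P + 2 * (T * e) ^ 2 := by
      rw [integral_add (hint.const_mul 2) (integrable_const _), integral_const_mul]
      simp
    have hint2 : Integrable (fun z => 2 * (T * g z - f z) ^ 2 + 2 * (T * e) ^ 2) P :=
      (hint.const_mul 2).add (integrable_const _)
    rw [← h2, ofReal_integral_eq_lintegral_ofReal hint2 (ae_of_all _ fun z => by positivity)]
    apply lintegral_mono_ae
    filter_upwards [ae_mem_of_measure_compl_eq_zero hP] with z hz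
    apply ENNReal.ofReal_le_ofReal
    rw [sq_abs]
    have h3 := hclose z (hΩ z hz)
    nlinarith [sq_nonneg ((T * g z - f z) - (estimator x yhat a z - T * g z))]
  refine h1.trans (ENNReal.ofReal_le_ofReal ?_)
  have h2 : ∑ i, (T * g (x i) - f (x i)) ^ 2
      ≤ 2 * ∑ i, (yhat i - f (x i)) ^ 2 + n * (2 * (T * e) ^ 2) := by
    have : ∀ i ∈ Finset.univ, (T * g (x i) - f (x i)) ^ 2
        ≤ 2 * (yhat i - f (x i)) ^ 2 + 2 * (T * e) ^ 2 := by
      intro i _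
      have h3 := hclose (x i) (hx i)
      rw [estimator_apply_data hfeas] at h3
      nlinarith [sq_nonneg ((yhat i - f (x i)) + (yhat i - T * g (x i)))]
    refine (Finset.sum_le_sum this).trans (le_of_eq ?_)
    simp [Finset.sum_add_distrib, Finset.mul_sum]
  have h3 : ∫ z, (T * g z - f z) ^ 2 ∂P - u
      ≤ 2 * ((1 / (n : ℝ)) * ∑ i, (yhat i - f (x i)) ^ 2) + 2 * (T * e) ^ 2 := by
    have h4 := hdev.trans h2
    rw [mul_comm, ← le_div_iff₀ hn'] at h4
    refine h4.trans (le_of_eq ?_)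
    field_simp
  linarith

/-- Deterministic core of the risk bound: if the noise and the empirical means are under control
on a cover of `UnitClass`, every solution has small excess risk. -/
theorem IsSolution.excessRisk_le {n d : ℕ} (hn : 0 < n) {M L R lam e : ℝ} (hM : 0 < M)
    (hR : 0 < R) (hL : 0 < L) (hlam : 0 < lam) (hlam1 : lam ≤ 1) (he : 0 < e) (he1 : e ≤ 1)
    (helam : e ≤ lam) (heM : 6 * M * e ≤ lam) (heT : e * (4 * M ^ 2 / lam + 1) ≤ M)
    {Ω : Set (Fin d → ℝ)} (hΩ : ∀ z ∈ Ω, ‖z‖ ≤ R)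
    {P : Measure (Fin d → ℝ)} [IsProbabilityMeasure P] (hP : P Ωᶜ = 0)
    {f : (Fin d → ℝ) → ℝ} (hf : ConvexOn ℝ Set.univ f) (hfm : Measurable f)
    (hfM : ∀ z ∈ Ω, |f z| ≤ M) (hpen : penalty Ω f ≤ ENNReal.ofReal L)
    {J : Finset ((Fin d → ℝ) → ℝ)}
    (hJ : ∀ g ∈ J, Measurable g ∧ ∀ z, ‖z‖ ≤ R → |g z| ≤ 4 * M + 2 * R + 1)
    (hcover : ∀ h, UnitClass R (4 * M + 2 * R) h → ∃ g ∈ J, ∀ z, ‖z‖ ≤ R → |h z - g z| ≤ e)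
    {x : Fin n → Fin d → ℝ} {ε yhat : Fin n → ℝ} {a : Fin n → Fin d → ℝ}
    (hx : ∀ i, x i ∈ Ω) (hε : ∀ i, |ε i| ≤ M) {Θ u : ℝ} (hΘ : Θ = 2 * L + 1 + 128 * M ^ 2)
    (hnoise : ∀ k < ⌊4 * M ^ 2 / lam⌋₊ + 1, ∀ g ∈ J,
      ∑ i, ε i * (((k : ℝ) + 1) * g (x i) - f (x i))
        ≤ (∑ i, (((k : ℝ) + 1) * g (x i) - f (x i)) ^ 2) / 8 + 32 * M ^ 2 * n * lam ^ 2)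
    (hdev : ∀ g ∈ J, n * (∫ z, ((Θ + 1) * g z - f z) ^ 2 ∂P - u)
      ≤ ∑ i, ((Θ + 1) * g (x i) - f (x i)) ^ 2)
    (h : IsSolution lam x (fun i => f (x i) + ε i) yhat a) :
    excessRisk P f (estimator x yhat a)
      ≤ ENNReal.ofReal (lam * (4 * Θ + 6 * (Θ + 1) ^ 2) + 2 * u) := by
  have hn' : (0 : ℝ) < n := by exact_mod_cast hn
  have hxR : ∀ i, ‖x i‖ ≤ R := fun i => hΩ _ (hx i)
  have hy : ∀ i, |f (x i) + ε i| ≤ 2 * M := fun i =>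
    (abs_add_le _ _).trans (by linarith [hfM _ (hx i), hε i])
  obtain ⟨hθ, hY⟩ := h.bounds hn hlam hM hy
  choose p hp using fun i => nonempty_subdifferential hf (x i)
  have hpL : slopeNorm p ≤ L := slopeNorm_le_of_penalty_le hn hL.le hpen hx hp
  set θ := slopeNorm a with hθ_def
  have hθ0 : 0 ≤ θ := slopeNorm_nonneg a
  have hθle : θ ≤ 4 * M ^ 2 / lam := by
    rw [le_div_iff₀ hlam]
    linarith
  -- Rounding the random slope size up to an integer leaves finitely many scales for the union
  -- bound.
  set T : ℝ := (⌊θ⌋₊ : ℝ) + 1 with hT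
  have hTθ : θ ≤ T := (Nat.lt_floor_add_one θ).le
  have hTθ' : T ≤ θ + 1 := by
    have := Nat.floor_le hθ0
    linarith
  have hT1 : 1 ≤ T := by
    have : (0 : ℝ) ≤ ⌊θ⌋₊ := Nat.cast_nonneg _
    linarith
  have hT0 : 0 < T := by linarith
  have hTe : T * e ≤ M := by nlinarith
  have hTe0 : 0 ≤ T * e := by positivity
  obtain ⟨g, hgJ, hg⟩ := hcover _ (unitClass_estimator hn hR hT1 h.1 hxR hY hTθ)
  have hemp := h.empirical_bound hn hlam hT0 hxR hε hp hpL hg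
    (hnoise ⌊θ⌋₊ (Nat.lt_succ_of_le (Nat.floor_le_floor hθle)) g hgJ)
  rw [← Finset.sum_div] at hemp
  set E := (1 / (n : ℝ)) * ∑ i, (yhat i - f (x i)) ^ 2 with hE
  have hE0 : 0 ≤ E := by positivity
  have hlast : lam * Θ = lam * (2 * L + 1 + 128 * M ^ 2) := by rw [hΘ]
  -- The approximation terms total at most `3 * M * (T * e) ≤ lam * (θ + 1) / 2`, so half the
  -- penalty absorbs their dependence on `θ`.
  have hkey : E / 2 + lam * θ / 2 ≤ lam * Θ / 2 := by
    have h1 : 32 * M ^ 2 * n * lam ^ 2 / n = 32 * M ^ 2 * lam ^ 2 := by field_simp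
    have h2 : M ^ 2 * lam ^ 2 ≤ M ^ 2 * lam :=
      mul_le_mul_of_nonneg_left (by nlinarith) (sq_nonneg M)
    have h3 : (T * e) ^ 2 ≤ M * (T * e) := by nlinarith
    have h4 : 6 * M * (T * e) ≤ lam * (θ + 1) := by
      calc 6 * M * (T * e) = 6 * M * e * T := by ring
        _ ≤ lam * (θ + 1) := mul_le_mul heM hTθ' hT0.le hlam.le
    have h5 : 0 ≤ M * (T * e) := by positivity
    have h6 : (1 / (n : ℝ)) * ((∑ i, (yhat i - f (x i)) ^ 2) / 2) = E / 2 := by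
      rw [hE]
      ring
    rw [h6, h1] at hemp
    rw [hlast]
    linarith
  have hEΘ : E ≤ lam * Θ := by nlinarith
  have hθΘ : θ ≤ Θ := by
    have h1 : lam * θ ≤ lam * Θ := by linarith
    exact le_of_mul_le_mul_left h1 hlam
  have hΘ0 : 0 ≤ Θ := hθ0.trans hθΘ
  -- Now `θ ≤ Θ`, so the estimator is rescaled by the deterministic `Θ + 1`, and population
  -- deviations are needed at this scale only.
  obtain ⟨g', hgJ', hg'⟩ := hcover _
    (unitClass_estimator (T := Θ + 1) hn hR (by linarith) h.1 hxR hY (by linarith))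
  refine (excessRisk_le_of_empirical hn (by linarith) hΩ hP hfm hfM (hJ g' hgJ').1 (hJ g' hgJ').2
    h.1 hxR hg' (hdev g' hgJ')).trans (ENNReal.ofReal_le_ofReal ?_)
  have h1 : ((Θ + 1) * e) ^ 2 ≤ (Θ + 1) ^ 2 * lam := by
    rw [mul_pow]
    exact mul_le_mul_of_nonneg_left (by nlinarith) (sq_nonneg _)
  rw [← hE]
  linarith

/-- When the regularization parameter is bounded below the risk of every solution is bounded. -/
lemma IsSolution.excessRisk_le_of_le {n d : ℕ} (hn : 0 < n) {M R lam c : ℝ} (hM : 0 < M)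
    (hR : 0 < R) (hc : 0 < c) (hlam : c ≤ lam)
    {Ω : Set (Fin d → ℝ)} (hΩ : ∀ z ∈ Ω, ‖z‖ ≤ R)
    {P : Measure (Fin d → ℝ)} [IsProbabilityMeasure P] (hP : P Ωᶜ = 0)
    {f : (Fin d → ℝ) → ℝ} (hfM : ∀ z ∈ Ω, |f z| ≤ M)
    {x : Fin n → Fin d → ℝ} {ε yhat : Fin n → ℝ} {a : Fin n → Fin d → ℝ}
    (hx : ∀ i, x i ∈ Ω) (hε : ∀ i, |ε i| ≤ M)
    (h : IsSolution lam x (fun i => f (x i) + ε i) yhat a) :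
    excessRisk P f (estimator x yhat a)
      ≤ ENNReal.ofReal ((5 * M + 2 * R * (4 * M ^ 2 / c)) ^ 2) := by
  have hy : ∀ i, |f (x i) + ε i| ≤ 2 * M := fun i =>
    (abs_add_le _ _).trans (by linarith [hfM _ (hx i), hε i])
  obtain ⟨hθ, hY⟩ := h.bounds hn (hc.trans_le hlam) hM hy
  have hθc : slopeNorm a ≤ 4 * M ^ 2 / c := by
    rw [le_div_iff₀ hc]
    nlinarith [slopeNorm_nonneg a]
  refine excessRisk_le_of_abs_sub_le hP fun z hz => ?_
  have h1 := abs_estimator_le hn h.1 (fun i => hΩ _ (hx i)) hY (hΩ z hz)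
  have h2 := hfM z hz
  have h3 : 2 * R * slopeNorm a ≤ 2 * R * (4 * M ^ 2 / c) := by gcongr
  have h4 := abs_sub (f z) (estimator x yhat a z)
  linarith

end RiskBounds

/-! ### Union bounds over the cover. -/

section HighProbability

variable {S : Type*} [MeasurableSpace S] {μ : Measure S} [IsProbabilityMeasure μ]

lemma measure_exists_noise_ge_le {n d : ℕ} {M t : ℝ} (hM : 0 < M) (ht : 0 < t)
    {x : Fin n → S → Fin d → ℝ} {ε : Fin n → S → ℝ} (hx : ∀ i, Measurable (x i))
    (hε : ∀ i, Measurable (ε i)) (hind : iIndepFun ε μ)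
    (hindx : IndepFun (fun ω i => x i ω) (fun ω i => ε i ω) μ)
    (hb : ∀ i, ∀ᵐ ω ∂μ, |ε i ω| ≤ M) (hmean : ∀ i, ∫ ω, ε i ω ∂μ = 0)
    {f : (Fin d → ℝ) → ℝ} (hf : Measurable f) {J : Finset ((Fin d → ℝ) → ℝ)}
    (hJ : ∀ g ∈ J, Measurable g) (m : ℕ) :
    μ {ω | ∃ k < m, ∃ g ∈ J, (∑ i, (((k : ℝ) + 1) * g (x i ω) - f (x i ω)) ^ 2) / 8 + t
        ≤ ∑ i, ε i ω * (((k : ℝ) + 1) * g (x i ω) - f (x i ω))}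
      ≤ ENNReal.ofReal (m * (J.card * Real.exp (-t / (4 * M ^ 2)))) := by
  have hset : {ω | ∃ k < m, ∃ g ∈ J, (∑ i, (((k : ℝ) + 1) * g (x i ω) - f (x i ω)) ^ 2) / 8 + t
        ≤ ∑ i, ε i ω * (((k : ℝ) + 1) * g (x i ω) - f (x i ω))}
      ⊆ ⋃ k ∈ Finset.range m, ⋃ g ∈ J,
        {ω | (∑ i, (((k : ℝ) + 1) * g (x i ω) - f (x i ω)) ^ 2) / 8 + t
          ≤ ∑ i, ε i ω * (((k : ℝ) + 1) * g (x i ω) - f (x i ω))} := by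
    rintro ω ⟨k, hk, g, hg, h⟩
    simp only [Set.mem_iUnion]
    exact ⟨k, Finset.mem_range.2 hk, g, hg, h⟩
  refine (measure_mono hset).trans ((measure_biUnion_finset_le _ _).trans ?_)
  calc _ ≤ ∑ _k ∈ Finset.range m, ∑ _g ∈ J, ENNReal.ofReal (Real.exp (-t / (4 * M ^ 2))) := by
        refine Finset.sum_le_sum fun k _ => (measure_biUnion_finset_le _ _).trans ?_
        refine Finset.sum_le_sum fun g hg => ?_
        have := hJ g hg
        exact measure_offset_le_sum hM ht hx hε hind hindx hb hmean
          (g := fun z => ((k : ℝ) + 1) * g z - f z) (by fun_prop)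
    _ = _ := by
        rw [ENNReal.ofReal_mul (Nat.cast_nonneg _), ENNReal.ofReal_mul (Nat.cast_nonneg _)]
        simp

lemma measure_exists_sum_le {n d : ℕ} {B M R T u : ℝ} (hBT : 0 < T * B + M) (hT : 0 < T)
    (hu : 0 ≤ u) {Ω : Set (Fin d → ℝ)} (hΩ : ∀ z ∈ Ω, ‖z‖ ≤ R)
    {P : Measure (Fin d → ℝ)} [IsProbabilityMeasure P] (hP : P Ωᶜ = 0)
    {x : Fin n → S → Fin d → ℝ} (hx : ∀ i, Measurable (x i)) (hind : iIndepFun x μ)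
    (hlaw : ∀ i, μ.map (x i) = P) {f : (Fin d → ℝ) → ℝ} (hf : Measurable f)
    (hfM : ∀ z ∈ Ω, |f z| ≤ M) {J : Finset ((Fin d → ℝ) → ℝ)}
    (hJ : ∀ g ∈ J, Measurable g ∧ ∀ z, ‖z‖ ≤ R → |g z| ≤ B) :
    μ {ω | ∃ g ∈ J, ∑ i, (T * g (x i ω) - f (x i ω)) ^ 2
        ≤ n * (∫ z, (T * g z - f z) ^ 2 ∂P - u)}
      ≤ ENNReal.ofReal (J.card * Real.exp (-(2 * n * u ^ 2) / ((T * B + M) ^ 2) ^ 2)) := by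
  have hset : {ω | ∃ g ∈ J, ∑ i, (T * g (x i ω) - f (x i ω)) ^ 2
        ≤ n * (∫ z, (T * g z - f z) ^ 2 ∂P - u)}
      ⊆ ⋃ g ∈ J, {ω | ∑ i, (T * g (x i ω) - f (x i ω)) ^ 2
        ≤ n * (∫ z, (T * g z - f z) ^ 2 ∂P - u)} := by
    rintro ω ⟨g, hg, h⟩
    simp only [Set.mem_iUnion]
    exact ⟨g, hg, h⟩
  refine (measure_mono hset).trans ((measure_biUnion_finset_le _ _).trans ?_)
  calc _ ≤ ∑ _g ∈ J,
        ENNReal.ofReal (Real.exp (-(2 * n * u ^ 2) / ((T * B + M) ^ 2) ^ 2)) := by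
        refine Finset.sum_le_sum fun g hg => ?_
        have hgm := (hJ g hg).1
        refine measure_sum_le_integral_sub (by positivity) hu hx hind hlaw
          (φ := fun z => (T * g z - f z) ^ 2) (by fun_prop) ?_
        filter_upwards [ae_mem_of_measure_compl_eq_zero hP] with z hz
        refine ⟨sq_nonneg _, ?_⟩
        rw [← sq_abs]
        refine pow_le_pow_left₀ (abs_nonneg _) ((abs_sub _ _).trans (add_le_add ?_ (hfM z hz))) 2
        rw [abs_mul, abs_of_pos hT]
        exact mul_le_mul_of_nonneg_left ((hJ g hg).2 z (hΩ z hz)) hT.le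
    _ = _ := by
        rw [ENNReal.ofReal_mul (Nat.cast_nonneg _)]
        simp

lemma rate_pos {n d : ℕ} {δ : ℝ} (hd : 1 ≤ d) (hdn : d ≤ n) : 0 < rate n d δ := by
  have hd' : (0 : ℝ) < d := by exact_mod_cast hd
  have hn' : (0 : ℝ) < n := by exact_mod_cast hd.trans hdn
  have h1 : 0 < ((n : ℝ) / d) ^ (-2 / ((d : ℝ) + 4)) := Real.rpow_pos_of_pos (by positivity) _
  have h2 : (0 : ℝ) < max 1 (Real.log ((n : ℝ) / d)) := lt_max_of_lt_left one_pos
  have h3 := Real.sqrt_nonneg (Real.log (1 / δ) / n)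
  have h4 := mul_pos h1 h2
  rw [rate]
  linarith

end HighProbability

end ConvexRegression

/-! ### Assembly of the main theorem. -/

theorem proposition1 (M : ℝ) (hM : 0 < M) :
    -- the choice of the regularization parameter: it may depend on `M`, `n`, `d`, `δ` only
    ∃ lam : ℕ → ℕ → ℝ → ℝ,
      (∀ (n d : ℕ) (δ : ℝ), 1 ≤ d → d ≤ n → 0 < δ → δ < 1 → 0 < lam n d δ) ∧
      ∀ R L : ℝ, 0 < R → 0 < L →
        -- the constant hidden in `O(·)`: it may depend on `M`, `R` and the bound `L` on `‖f‖` only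
        ∃ C : ℝ, 0 < C ∧
          ∀ (d n : ℕ), 1 ≤ d → d ≤ n →
          ∀ (δ : ℝ), 0 < δ → δ < 1 →
          -- the compact domain and the law of the predictors
          ∀ (Ω : Set (Fin d → ℝ)), IsCompact Ω → (∀ z ∈ Ω, ‖z‖ ≤ R) →
          ∀ (P : Measure (Fin d → ℝ)) [IsProbabilityMeasure P], P Ωᶜ = 0 →
          -- the regression function
          ∀ (f : (Fin d → ℝ) → ℝ), ConvexOn ℝ Set.univ f → (∀ z ∈ Ω, |f z| ≤ M) →
            ConvexRegression.penalty Ω f ≤ ENNReal.ofReal L →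
          -- the i.i.d. predictors and the independent, centered, bounded noise
          ∀ (S : Type*) [MeasurableSpace S] (μ : Measure S) [IsProbabilityMeasure μ]
            (x : Fin n → S → Fin d → ℝ) (ε : Fin n → S → ℝ),
            (∀ i, Measurable (x i)) → (∀ i, Measurable (ε i)) →
            iIndepFun x μ → (∀ i, μ.map (x i) = P) →
            iIndepFun ε μ →
            IndepFun (fun ω i => x i ω) (fun ω i => ε i ω) μ →
            (∀ i, ∀ᵐ ω ∂μ, |ε i ω| ≤ M) → (∀ i, ∫ ω, ε i ω ∂μ = 0) →
          -- the program always has a solution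
          (∀ ω, ∃ yhat a, ConvexRegression.IsSolution (lam n d δ)
              (fun i => x i ω) (fun i => f (x i ω) + ε i ω) yhat a) ∧
          -- outside an event of probability at most `δ`, every solution obeys the risk bound
          μ {ω | ¬ ∀ yhat a, ConvexRegression.IsSolution (lam n d δ)
                (fun i => x i ω) (fun i => f (x i ω) + ε i ω) yhat a →
              ConvexRegression.excessRisk P f
                  (ConvexRegression.estimator (fun i => x i ω) yhat a)
                ≤ ENNReal.ofReal (C * ConvexRegression.rate n d δ)}
            ≤ ENNReal.ofReal δ := by
  refine ⟨ConvexRegression.rate, fun n d δ hd hdn _ _ => ConvexRegression.rate_pos hd hdn, ?_⟩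
  intro R L hR hL
  obtain ⟨c, hc, hc1, hsmall⟩ := ConvexRegression.exists_rate_threshold hM hR
  set Θ := 2 * L + 1 + 128 * M ^ 2 with hΘ
  set b := (Θ + 1) * (4 * M + 2 * R + 1) + M with hb
  set C₁ := (5 * M + 2 * R * (4 * M ^ 2 / c)) ^ 2 / c with hC₁
  set C₂ := 4 * Θ + 6 * (Θ + 1) ^ 2 + 4 * b ^ 2 with hC₂
  have hΘ0 : 0 < Θ := by positivity
  have hb0 : 0 < b := by positivity
  have hC₁0 : 0 < C₁ := by positivity
  have hC₂0 : 0 < C₂ := by positivity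
  refine ⟨C₁ + C₂, by positivity, ?_⟩
  intro d n hd hdn δ hδ hδ1 Ω _ hΩR P _ hP f hf hfM hpen S _ μ _ x ε hx hε hindx hlaw hindε hxε hεM
    hmean
  have hn : 0 < n := lt_of_lt_of_le hd hdn
  have hn' : (0 : ℝ) < n := by exact_mod_cast hn
  have hlam : 0 < ConvexRegression.rate n d δ := ConvexRegression.rate_pos hd hdn
  refine ⟨fun ω => ConvexRegression.exists_isSolution hn hlam _ _, ?_⟩
  set lam := ConvexRegression.rate n d δ with hlam_def
  have hfm : Measurable f := (continuousOn_univ.1 (hf.continuousOn isOpen_univ)).measurable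
  have hgood : ∀ᵐ ω ∂μ, (∀ i, x i ω ∈ Ω) ∧ ∀ i, |ε i ω| ≤ M := by
    have h1 : ∀ i, ∀ᵐ ω ∂μ, x i ω ∈ Ω := fun i =>
      ae_of_ae_map (hx i).aemeasurable
        (by rw [hlaw i]; exact ConvexRegression.ae_mem_of_measure_compl_eq_zero hP)
    filter_upwards [ae_all_iff.2 h1, ae_all_iff.2 hεM] with ω h2 h3
    exact ⟨h2, h3⟩
  have hnull : μ {ω | ¬ ((∀ i, x i ω ∈ Ω) ∧ ∀ i, |ε i ω| ≤ M)} = 0 := hgood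
  rcases le_or_gt c lam with hcl | hcl
  -- When `lam ≥ c`, the constant risk bound is `C₁ * c ≤ C₁ * lam`.
  · refine le_trans (measure_mono ?_) (hnull.le.trans zero_le)
    intro ω hω hgω
    refine hω fun yhat a hsol => ?_
    refine (hsol.excessRisk_le_of_le hn hM hR hc hcl hΩR hP hfM hgω.1 hgω.2).trans
      (ENNReal.ofReal_le_ofReal ?_)
    have h1 : (5 * M + 2 * R * (4 * M ^ 2 / c)) ^ 2 = C₁ * c := by
      rw [hC₁]
      field_simp
    rw [h1]
    have h2 : C₁ * c ≤ C₁ * lam := by gcongr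
    have h3 : 0 ≤ C₂ * lam := by positivity
    linarith
  · obtain ⟨e, he, he1, helam, heM, heT, hcount⟩ := hsmall n d δ hd hdn hδ hδ1 hcl
    rw [← hlam_def] at helam heM heT hcount
    obtain ⟨J, hJcard, hJ, hcover⟩ := ConvexRegression.exists_cover_unitClass (d := d) (R := R)
      (B := 4 * M + 2 * R) (r := √e) hd hR (by positivity) (Real.sqrt_pos.2 he)
      (Real.sqrt_le_one.2 he1)
    rw [Real.sq_sqrt he.le] at hJcard hcover
    set m := ⌊4 * M ^ 2 / lam⌋₊ + 1 with hm
    have hB1 := ConvexRegression.measure_exists_noise_ge_le hM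
      (show 0 < 32 * M ^ 2 * n * lam ^ 2 by positivity) hx hε hindε hxε hεM hmean hfm
      (fun g hg => (hJ g hg).1) m
    -- `b` bounds `|(Θ + 1) * g - f|` on `Ω`; this `u` gives the Hoeffding tail the same exponent
    -- `-8 * n * lam ^ 2` as the noise tail.
    have hB2 := ConvexRegression.measure_exists_sum_le (μ := μ) (u := 2 * b ^ 2 * lam)
      hb0 (by linarith : 0 < Θ + 1) (by positivity) hΩR hP hx hindx hlaw hfm hfM hJ
    have e1 : -(32 * M ^ 2 * n * lam ^ 2) / (4 * M ^ 2) = -(8 * n * lam ^ 2) := by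
      field_simp
      ring
    have e2 : -(2 * n * (2 * b ^ 2 * lam) ^ 2) / (b ^ 2) ^ 2 = -(8 * n * lam ^ 2) := by
      field_simp
      ring
    rw [e1] at hB1
    rw [← hb, e2] at hB2
    refine le_trans (measure_mono (t := {ω | ¬ ((∀ i, x i ω ∈ Ω) ∧ ∀ i, |ε i ω| ≤ M)} ∪ (_ ∪ _))
      ?_) ((measure_union_le _ _).trans (add_le_add hnull.le ((measure_union_le _ _).trans
        (add_le_add hB1 hB2)))) |>.trans ?_
    · intro ω hω
      by_contra hcon
      simp only [Set.mem_union, not_or, Set.mem_ofPred_eq] at hcon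
      obtain ⟨hgω, hn1, hn2⟩ := hcon
      rw [not_not] at hgω
      simp only [not_exists, not_and, not_le] at hn1 hn2
      refine hω fun yhat a hsol => ?_
      refine (hsol.excessRisk_le hn hM hR hL hlam (hcl.le.trans hc1) he he1 helam heM heT hΩR hP hf
        hfm hfM hpen hJ hcover (fun i => hgω.1 i) (fun i => hgω.2 i) hΘ
        (fun k hk g hg => (hn1 k hk g hg).le) (fun g hg => (hn2 g hg).le)).trans
        (ENNReal.ofReal_le_ofReal ?_)
      have h1 : 0 ≤ C₁ * lam := by positivity
      rw [hC₂]
      linarith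
    · rw [zero_add, ← ENNReal.ofReal_add (by positivity) (by positivity)]
      apply ENNReal.ofReal_le_ofReal
      refine le_trans ?_ hcount
      have hmle : (m : ℝ) ≤ 4 * M ^ 2 / lam + 1 := by
        rw [hm]
        push_cast
        linarith [Nat.floor_le (by positivity : 0 ≤ 4 * M ^ 2 / lam)]
      have hp := Real.exp_pos (-(8 * n * lam ^ 2))
      have h1 : J.card * Real.exp (-(8 * n * lam ^ 2))
          ≤ ConvexRegression.coverBound d R (4 * M + 2 * R) e * Real.exp (-(8 * n * lam ^ 2)) :=
        mul_le_mul_of_nonneg_right hJcard hp.le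
      have h2 : 0 ≤ J.card * Real.exp (-(8 * n * lam ^ 2)) := by positivity
      have h3 : 1 ≤ 4 * M ^ 2 / lam + 1 := by
        have : 0 ≤ 4 * M ^ 2 / lam := by positivity
        linarith
      calc _ ≤ (4 * M ^ 2 / lam + 1) * (J.card * Real.exp (-(8 * n * lam ^ 2)))
            + (4 * M ^ 2 / lam + 1) * (J.card * Real.exp (-(8 * n * lam ^ 2))) :=
            add_le_add (mul_le_mul_of_nonneg_right hmle h2) (le_mul_of_one_le_left h2 h3)
        _ = 2 * (4 * M ^ 2 / lam + 1) * (J.card * Real.exp (-(8 * n * lam ^ 2))) := by ring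
        _ ≤ 2 * (4 * M ^ 2 / lam + 1) * (ConvexRegression.coverBound d R (4 * M + 2 * R) e *
            Real.exp (-(8 * n * lam ^ 2))) := mul_le_mul_of_nonneg_left h1 (by linarith)
        _ = _ := by ring
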